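/- **Setting.** Let $d\ge 1$, $\lambda,\Lambda\in(0,\infty)$, and let $W:[-1,1]\to[0,\infty)$ be continuous with $W^{-1}(\{0\})=\{-1,1\}$. Let $\mathscr F_d(\lambda,\Lambda)$ be the set of continuous $\varphi:S^{d-1}\to[0,\infty)$ with $\sqrt\lambda\le\varphi\le\sqrt\Lambda$ whose one-homogeneous extension to $\mathbb R^d$ is convex, with the Borel $\sigma$-algebra of the supremum norm. Let $(\Omega,\mathscr B,\mathbb P)$ be a probability space, $\Phi:\Omega\to\mathscr F_d(\lambda,\Lambda)$ measurable, and $\tau:\mathbb R^d\times\Omega\to\Omega$ a group action ($\tau_{x+y}=\tau_x\circ\tau_y$, $\tau_0=\mathrm{Id}$) that is measurable with respect to the product of the Lebesgue $\sigma$-algebra and $\mathscr B$, preserves $\mathbb P$, and is ergodic (if $E\in\mathscr B$ and $\tau_x^{-1}(E)=E$ for all $x$, then $\mathbb P(E)\in\{0,1\}$). Put $\varphi^\omega(x,p)=\|p\|\,\Phi^{\tau_x\omega}(p/\|p\|)$ for $p\ne0$, $\varphi^\omega(x,0)=0$, and $$\mathcal F^\omega(u;A)=\int_A\Big(\tfrac12\varphi^\omega(x,Du(x))^2+W(u(x))\Big)\,dx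 .$$ Let $\Sigma$ be the $\sigma$-algebra of all $E\in\mathscr B$ with $\tau_x^{-1}(E)=E$ for every $x\in\mathbb R^d$. Call $q:\mathbb R\to[-1,1]$ admissible if it is locally absolutely continuous, $\lim_{s\to\pm\infty}q(s)=\pm1$ and $\int_{-\infty}^\infty\big(\tfrac\Lambda2 q'(s)^2+W(q(s))\big)ds<\infty$; for $e\in S^{d-1}$ set $q_e(y)=q(\langle y,e\rangle)$. Fix $e\in S^{d-1}$, a linear isometry $O_e:\mathbb R^{d-1}\to\mathbb R^d$ with range $\{x:\langle x,e\rangle=0\}$, and an orthonormal basis of $\mathbb R^{d-1}$; let $Q(0,R)\subset\mathbb R^{d-1}$ be the open cube centred at $0$ with side length $R$ oriented along that basis. For admissible $q$ and $R>0$ put $D_R=\{O_e(y)+te: y\in Q(0,R),\ |t|<R\}$ and $$\tilde\varphi^\omega(e,Q(0,R),R)=\inf\big\{\mathcal F^\omega(u;D_R): u\in H^1(D_R),\ -1\le u\le1\text{ a.e.},\ u-q_e\in H^1_0(D_R)\big\},$$ $$\tilde\varphi^\omega(e)=\liminf_{R\to\infty}R^{1-d}\,\tilde\varphi^\omega(e,Q(0,R),R).$$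 **Theorem.** For every admissible $q$, $\tilde\varphi^\omega(e)$ is finite for every $\omega\in\Omega$, the function $\omega\mapsto\tilde\varphi^\omega(e)$ is $\Sigma$-measurable, and $\tilde\varphi^{\tau_x\omega}(e)=\tilde\varphi^\omega(e)$ for all $x\in\mathbb R^d$ and $\omega\in\Omega$. **Corollary.** There is a unique real number $\tilde\varphi(e)\ge0$, not depending on $q$ (nor on $\omega$), such that for every admissible $q$, $\tilde\varphi^\omega(e)=\tilde\varphi(e)$ for $\mathbb P$-almost every $\omega$. -/

import Mathlib

open MeasureTheory Filter Topology Set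
open scoped ENNReal

namespace SurfaceTension

noncomputable section

/-- `d`-dimensional Euclidean space. -/
abbrev E (d : ℕ) : Type := EuclideanSpace ℝ (Fin d)

/-! ### Finsler norms and the random medium -/

/-- The unit sphere of `ℝᵈ`. -/
abbrev Sph (d : ℕ) : Type := Metric.sphere (0 : E d) 1

/-- The one-homogeneous extension to `ℝᵈ` of a function on the unit sphere. -/
def homogExt {d : ℕ} (f : Sph d → ℝ) (p : E d) : ℝ :=
  if h : p = 0 then 0 else
    ‖p‖ * f ⟨‖p‖⁻¹ • p, by
      rw [mem_sphere_zero_iff_norm, norm_smul, norm_inv, norm_norm,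
        inv_mul_cancel₀ (norm_ne_zero_iff.mpr h)]⟩

/-- Continuous functions on the sphere, with values in `[√lam, √Lam]`, whose one-homogeneous
extension is convex. The set carries the topology of the supremum norm. -/
def FinslerNorms (d : ℕ) (lam Lam : ℝ) : Set C(Sph d, ℝ) :=
  {f | (∀ e, √lam ≤ f e ∧ f e ≤ √Lam) ∧ ConvexOn ℝ univ (homogExt f)}

/-- `τ` is a measurable, measure preserving, ergodic action of `ℝᵈ` on `(Ω, P)`.
Joint measurability refers to the Lebesgue measurable (that is, null measurable) subsets of `ℝᵈ`. -/
structure IsErgodicAction {d : ℕ} {Ω : Type*} [MeasurableSpace Ω] (P : Measure Ω)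
    (τ : E d → Ω → Ω) : Prop where
  measurable :
    Measurable (fun z : NullMeasurableSpace (E d) volume × Ω => τ (show E d from z.1) z.2)
  zero : τ 0 = id
  add : ∀ x y, τ (x + y) = τ x ∘ τ y
  preserves : ∀ (x : E d) (A : Set Ω), MeasurableSet A → P (τ x ⁻¹' A) = P A
  ergodic : ∀ A : Set Ω, MeasurableSet A → (∀ x, τ x ⁻¹' A = A) → P A = 0 ∨ P A = 1

/-- The `σ`-algebra `Σ` of measurable sets `A` with `τ_x⁻¹ A = A` for every `x ∈ ℝᵈ`. -/
abbrev invariantSigma {d : ℕ} {Ω : Type*} [MeasurableSpace Ω] (τ : E d → Ω → Ω) :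
    MeasurableSpace Ω :=
  ⨅ x : E d, MeasurableSpace.invariants (τ x)

theorem measurableSet_invariantSigma {d : ℕ} {Ω : Type*} [MeasurableSpace Ω] (τ : E d → Ω → Ω)
    (A : Set Ω) :
    MeasurableSet[invariantSigma τ] A ↔ MeasurableSet A ∧ ∀ x, τ x ⁻¹' A = A := by
  rw [MeasurableSpace.measurableSet_iInf]
  exact ⟨fun h => ⟨(h 0).1, fun x => (h x).2⟩, fun h x => ⟨h.1, h.2 x⟩⟩

/-- The stationary Finsler metric `φ^ω(x, p)`. -/
def finslerMetric {d : ℕ} {lam Lam : ℝ} {Ω : Type*} (τ : E d → Ω → Ω)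
    (Φ : Ω → FinslerNorms d lam Lam) (ω : Ω) (x p : E d) : ℝ :=
  homogExt (Φ (τ x ω)).1 p

/-! ### Sobolev spaces on an open set -/

/-- `u ∈ H¹(A)` with (weak) gradient `g`: `H¹(A)` is the closure of `C^∞(A)` for the norm
`‖f‖² = ∫_A (f² + |Df|²)`, so `(u, g)` is an `L²(A)`-limit of pairs `(f, Df)` with
`f ∈ C^∞(A)`. -/
def HasH1Gradient {d : ℕ} (A : Set (E d)) (u : E d → ℝ) (g : E d → E d) : Prop :=
  MemLp u 2 (volume.restrict A) ∧ MemLp g 2 (volume.restrict A) ∧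
    ∀ ε : ℝ≥0∞, 0 < ε → ∃ f : E d → ℝ, ContDiffOn ℝ ((⊤ : ℕ∞) : WithTop ℕ∞) f A ∧
      eLpNorm (u - f) 2 (volume.restrict A) < ε ∧
      eLpNorm (g - gradient f) 2 (volume.restrict A) < ε

/-- `v ∈ H¹₀(A)`: the closure of `C_c^∞(A)` in `H¹(A)`. -/
def MemH10 {d : ℕ} (A : Set (E d)) (v : E d → ℝ) : Prop :=
  MemLp v 2 (volume.restrict A) ∧ ∃ g : E d → E d, MemLp g 2 (volume.restrict A) ∧
    ∀ ε : ℝ≥0∞, 0 < ε → ∃ f : E d → ℝ, ContDiff ℝ ((⊤ : ℕ∞) : WithTop ℕ∞) f ∧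
      HasCompactSupport f ∧ tsupport f ⊆ A ∧
      eLpNorm (v - f) 2 (volume.restrict A) < ε ∧
      eLpNorm (g - gradient f) 2 (volume.restrict A) < ε

/-! ### The energy and the boundary data -/

/-- A double-well potential; only its values on `[-1, 1]` are ever used. -/
structure IsDoubleWell (W : ℝ → ℝ) : Prop where
  continuousOn : ContinuousOn W (Icc (-1) 1)
  nonneg : ∀ s ∈ Icc (-1 : ℝ) 1, 0 ≤ W s
  zero_iff : ∀ s ∈ Icc (-1 : ℝ) 1, W s = 0 ↔ s = -1 ∨ s = 1

/-- A (locally) absolutely continuous profile `q : ℝ → [-1, 1]` of finite energy connecting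
`-1` to `1`. -/
structure IsProfile (Lam : ℝ) (W q : ℝ → ℝ) : Prop where
  mem_Icc : ∀ s, q s ∈ Icc (-1 : ℝ) 1
  absCont : ∀ a b, AbsolutelyContinuousOnInterval q a b
  finite_energy : Integrable (fun s => Lam / 2 * deriv q s ^ 2 + W (q s))
  tendsto_atTop : Tendsto q atTop (𝓝 1)
  tendsto_atBot : Tendsto q atBot (𝓝 (-1))

/-- The translated planar function `T_{x₀} q_e`. -/
def planar {d : ℕ} (q : ℝ → ℝ) (e x₀ : E d) (y : E d) : ℝ :=
  q (inner ℝ (y - x₀) e)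

/-- The energy `𝓕^ω(u; A) ∈ [0, ∞]` of a function `u` with gradient `g`. -/
def energy {d : ℕ} {lam Lam : ℝ} {Ω : Type*} (W : ℝ → ℝ) (τ : E d → Ω → Ω)
    (Φ : Ω → FinslerNorms d lam Lam) (ω : Ω) (A : Set (E d)) (u : E d → ℝ) (g : E d → E d) :
    ℝ≥0∞ :=
  ∫⁻ x in A, ENNReal.ofReal (1 / 2 * finslerMetric τ Φ ω x (g x) ^ 2 + W (u x))

/-! ### Finite-volume and infinite-volume surface tension -/

/-- Finite-volume surface tension: the infimum of `𝓕^ω(u; A)` over `u ∈ H¹(A; [-1, 1])` with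
`u - T_{x₀} q_e ∈ H¹₀(A)`. -/
def finiteVolume {d : ℕ} {lam Lam : ℝ} {Ω : Type*} (W : ℝ → ℝ) (τ : E d → Ω → Ω)
    (Φ : Ω → FinslerNorms d lam Lam) (q : ℝ → ℝ) (ω : Ω) (e x₀ : E d) (A : Set (E d)) : ℝ≥0∞ :=
  sInf {r | ∃ (u : E d → ℝ) (g : E d → E d), HasH1Gradient A u g ∧
    (∀ᵐ x ∂(volume.restrict A), u x ∈ Icc (-1 : ℝ) 1) ∧
    MemH10 A (u - planar q e x₀) ∧ r = energy W τ Φ ω A u g}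

/-- The open cube of side length `r` centred at `y` and oriented along the orthonormal basis `b`. -/
def cube {n : ℕ} (b : OrthonormalBasis (Fin n) ℝ (E n)) (y : E n) (r : ℝ) : Set (E n) :=
  {x | ∀ i, |inner ℝ (x - y) (b i)| < r / 2}

/-- The set `A ⊕_e I = {O y + t e : y ∈ A, t ∈ I}`. -/
def directSum {n d : ℕ} (O : E n →ₗᵢ[ℝ] E d) (e : E d) (A : Set (E n)) (I : Set ℝ) : Set (E d) :=
  {x | ∃ y ∈ A, ∃ t ∈ I, x = O y + t • e}

/-- The centred finite-volume surface tension in the cylinder `A ⊕_e (-h, h)`. -/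
def centered {n d : ℕ} {lam Lam : ℝ} {Ω : Type*} (W : ℝ → ℝ) (τ : E d → Ω → Ω)
    (Φ : Ω → FinslerNorms d lam Lam) (q : ℝ → ℝ) (O : E n →ₗᵢ[ℝ] E d) (ω : Ω) (e : E d)
    (A : Set (E n)) (h : ℝ) : ℝ≥0∞ :=
  finiteVolume W τ Φ q ω e 0 (directSum O e A (Ioo (-h) h))

/-- The infinite-volume surface tension
`liminf_{R → ∞} R^{1-d} φ̃^ω(e, Q(0,R), R)` (over real `R`). -/
def infiniteVolume {n d : ℕ} {lam Lam : ℝ} {Ω : Type*} (W : ℝ → ℝ) (τ : E d → Ω → Ω)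
    (Φ : Ω → FinslerNorms d lam Lam) (q : ℝ → ℝ) (b : OrthonormalBasis (Fin n) ℝ (E n))
    (O : E n →ₗᵢ[ℝ] E d) (e : E d) (ω : Ω) : ℝ≥0∞ :=
  liminf (fun R : ℝ =>
    ENNReal.ofReal (R ^ (1 - (d : ℝ))) * centered W τ Φ q O ω e (cube b 0 R) R) atTop

end

end SurfaceTension

open SurfaceTension

/-! Everything rests on one comparison, `eventually_finiteVolume_le`. Write n = d - 1. For profiles
q₁, q₂, a shift x and δ > 0, if R is large and R' exceeds R + 2‖x‖ by an amount in [3, 5], the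
minimal energy for q₂ and ω in the cylinder of size R' is at most that for q₁ and τ_x ω in the
cylinder of size R, plus δ R^n, uniformly in ω.

To see this, translate a competitor by x. Stationarity preserves its energy, up to replacing τ_x ω
by ω. Then extend it by χ q₁(· - x) + (1 - χ) q₂, where the cutoff χ has gradient bounded
independently of R (`finiteVolume_le_energy_add`). Both profiles tend to the same wells ±1, so the
density in the added layer is at most ε + ψ(height), with ψ integrable and independent of R
(`exists_interpolation_density_bound`). The lateral layer has cross section O(R^(n-1)) and height
O(R): it costs O(ε R^n) plus O(R^(n-1)) times the integral of ψ. The caps have bounded thickness and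
see only the tails of ψ. Choosing ε small gives δ R^n (`eventually_layer_le`).

After division by R^n, the comparison for x and for -x gives invariance. For x = 0 it gives
independence of the profile. Since the window for R' has length 2 and contains an integer, it also
shows that the liminf over real R equals the liminf over integers, so that measurability reduces to
finite volume. There the infimum may be taken over a countable L²-dense set of competitors, because
the energy is continuous in L²; each energy is measurable in ω by Tonelli's theorem. Finiteness
follows by testing with the planar function itself, and ergodicity makes the invariant limit almost
surely constant. -/

namespace SurfaceTension

/-! ### Sobolev functions as limits of smooth functions -/

/-- `v ∈ H¹₀(A)` with gradient `g`: the pair `(v, g)` is an `L²(A)`-limit of pairs `(f, Df)` with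
`f ∈ C_c^∞(A)`. -/
def HasH10Gradient {d : ℕ} (A : Set (E d)) (v : E d → ℝ) (g : E d → E d) : Prop :=
  MemLp v 2 (volume.restrict A) ∧ MemLp g 2 (volume.restrict A) ∧
    ∀ ε : ℝ≥0∞, 0 < ε → ∃ f : E d → ℝ, ContDiff ℝ ((⊤ : ℕ∞) : WithTop ℕ∞) f ∧
      HasCompactSupport f ∧ tsupport f ⊆ A ∧
      eLpNorm (v - f) 2 (volume.restrict A) < ε ∧
      eLpNorm (g - gradient f) 2 (volume.restrict A) < ε

variable {d : ℕ} {A B : Set (E d)} {u v f χ : E d → ℝ} {g k : E d → E d}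

theorem memH10_iff_exists : MemH10 A v ↔ ∃ g, HasH10Gradient A v g :=
  ⟨fun ⟨hv, g, hg, h⟩ => ⟨g, hv, hg, h⟩, fun ⟨g, hv, hg, h⟩ => ⟨hv, g, hg, h⟩⟩

theorem HasH10Gradient.hasH1Gradient (h : HasH10Gradient A v g) : HasH1Gradient A v g :=
  ⟨h.1, h.2.1, fun ε hε =>
    let ⟨f, hf, _, _, h1, h2⟩ := h.2.2 ε hε
    ⟨f, hf.contDiffOn, h1, h2⟩⟩

theorem gradient_add {x : E d} (hu : DifferentiableAt ℝ u x) (hv : DifferentiableAt ℝ v x) :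
    gradient (u + v) x = gradient u x + gradient v x := by
  simp [gradient, fderiv_add hu hv]

theorem gradient_neg (x : E d) : gradient (-u) x = -gradient u x := by
  simp [gradient, fderiv_neg]

theorem gradient_mul {x : E d} (hu : DifferentiableAt ℝ u x) (hv : DifferentiableAt ℝ v x) :
    gradient (fun y => u y * v y) x = u x • gradient v x + v x • gradient u x := by
  simp [gradient, fderiv_fun_mul hu hv]

theorem norm_gradient (x : E d) : ‖gradient u x‖ = ‖fderiv ℝ u x‖ := by
  simp [gradient]

theorem differentiableAt_of_contDiffOn (hA : IsOpen A)
    (hf : ContDiffOn ℝ ((⊤ : ℕ∞) : WithTop ℕ∞) f A) {x : E d} (hx : x ∈ A) :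
    DifferentiableAt ℝ f x :=
  (hf.contDiffAt (hA.mem_nhds hx)).differentiableAt (by simp)

theorem continuousOn_gradient (hA : IsOpen A)
    (hf : ContDiffOn ℝ ((⊤ : ℕ∞) : WithTop ℕ∞) f A) : ContinuousOn (gradient f) A :=
  (InnerProductSpace.toDual ℝ (E d)).symm.continuous.comp_continuousOn
    (hf.continuousOn_fderiv_of_isOpen hA (by simp))

theorem aestronglyMeasurable_of_contDiffOn (hA : IsOpen A)
    (hf : ContDiffOn ℝ ((⊤ : ℕ∞) : WithTop ℕ∞) f A) :
    AEStronglyMeasurable f (volume.restrict A) :=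
  hf.continuousOn.aestronglyMeasurable hA.measurableSet

theorem aestronglyMeasurable_gradient (hA : IsOpen A)
    (hf : ContDiffOn ℝ ((⊤ : ℕ∞) : WithTop ℕ∞) f A) :
    AEStronglyMeasurable (gradient f) (volume.restrict A) :=
  (continuousOn_gradient hA hf).aestronglyMeasurable hA.measurableSet

theorem gradient_eq_zero_of_notMem_tsupport {x : E d} (hx : x ∉ tsupport f) :
    gradient f x = 0 := by
  have : fderiv ℝ f x = 0 := by
    by_contra h
    exact hx (support_fderiv_subset ℝ h)
  simp [gradient, this]

theorem eLpNorm_add_sub_add_lt {F : Type*} [NormedAddCommGroup F] {μ : Measure (E d)}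
    {a b a' b' : E d → F} (ha : AEStronglyMeasurable a μ) (hb : AEStronglyMeasurable b μ)
    (ha' : AEStronglyMeasurable a' μ) (hb' : AEStronglyMeasurable b' μ) {ε : ℝ≥0∞}
    (h : eLpNorm (a - a') 2 μ < ε / 2) (h' : eLpNorm (b - b') 2 μ < ε / 2) :
    eLpNorm (a + b - (a' + b')) 2 μ < ε := by
  rw [add_sub_add_comm]
  calc _ ≤ _ := eLpNorm_add_le (ha.sub ha') (hb.sub hb') (by norm_num)
    _ < ε / 2 + ε / 2 := ENNReal.add_lt_add h h'
    _ = ε := ENNReal.add_halves ε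

theorem HasH1Gradient.add (hA : IsOpen A) (hu : HasH1Gradient A u g) (hv : HasH1Gradient A v k) :
    HasH1Gradient A (u + v) (g + k) := by
  refine ⟨hu.1.add hv.1, hu.2.1.add hv.2.1, fun ε hε => ?_⟩
  obtain ⟨a, ha, ha1, ha2⟩ := hu.2.2 (ε / 2) (ENNReal.half_pos hε.ne')
  obtain ⟨b, hb, hb1, hb2⟩ := hv.2.2 (ε / 2) (ENNReal.half_pos hε.ne')
  refine ⟨a + b, ha.add hb, eLpNorm_add_sub_add_lt hu.1.1 hv.1.1
    (aestronglyMeasurable_of_contDiffOn hA ha) (aestronglyMeasurable_of_contDiffOn hA hb) ha1 hb1,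
    ?_⟩
  refine (eLpNorm_congr_ae ?_).trans_lt (eLpNorm_add_sub_add_lt hu.2.1.1 hv.2.1.1
    (aestronglyMeasurable_gradient hA ha) (aestronglyMeasurable_gradient hA hb) ha2 hb2)
  filter_upwards [ae_restrict_mem hA.measurableSet] with x hx
  simp [gradient_add (differentiableAt_of_contDiffOn hA ha hx)
    (differentiableAt_of_contDiffOn hA hb hx)]

theorem HasH10Gradient.add (hA : IsOpen A) (hu : HasH10Gradient A u g)
    (hv : HasH10Gradient A v k) : HasH10Gradient A (u + v) (g + k) := by
  refine ⟨hu.1.add hv.1, hu.2.1.add hv.2.1, fun ε hε => ?_⟩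
  obtain ⟨a, ha, hac, has, ha1, ha2⟩ := hu.2.2 (ε / 2) (ENNReal.half_pos hε.ne')
  obtain ⟨b, hb, hbc, hbs, hb1, hb2⟩ := hv.2.2 (ε / 2) (ENNReal.half_pos hε.ne')
  refine ⟨a + b, ha.add hb, hac.add hbc, (tsupport_add a b).trans (union_subset has hbs),
    eLpNorm_add_sub_add_lt hu.1.1 hv.1.1
    (aestronglyMeasurable_of_contDiffOn hA ha.contDiffOn)
    (aestronglyMeasurable_of_contDiffOn hA hb.contDiffOn) ha1 hb1, ?_⟩
  refine (eLpNorm_congr_ae ?_).trans_lt (eLpNorm_add_sub_add_lt hu.2.1.1 hv.2.1.1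
    (aestronglyMeasurable_gradient hA ha.contDiffOn)
    (aestronglyMeasurable_gradient hA hb.contDiffOn) ha2 hb2)
  filter_upwards [ae_restrict_mem hA.measurableSet] with x hx
  simp [gradient_add (differentiableAt_of_contDiffOn hA ha.contDiffOn hx)
    (differentiableAt_of_contDiffOn hA hb.contDiffOn hx)]

theorem HasH1Gradient.neg (hu : HasH1Gradient A u g) : HasH1Gradient A (-u) (-g) := by
  refine ⟨hu.1.neg, hu.2.1.neg, fun ε hε => ?_⟩
  obtain ⟨a, ha, ha1, ha2⟩ := hu.2.2 ε hε
  refine ⟨-a, ha.neg, ?_, ?_⟩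
  · rwa [neg_sub_neg, eLpNorm_sub_comm]
  · have : gradient (-a) = -gradient a := funext gradient_neg
    rwa [this, neg_sub_neg, eLpNorm_sub_comm]

/-! ### Multiplication by cutoff functions -/

/-- By the product rule, a cutoff turns errors a (gradient) and b (function) into a + K b. This
chooses the tolerance accordingly. -/
theorem exists_pos_add_mul_lt {ε : ℝ≥0∞} (hε : 0 < ε) (K : NNReal) :
    ∃ δ : ℝ≥0∞, 0 < δ ∧ δ ≤ ε ∧ ∀ a b, a < δ → b < δ → a + K * b < ε := by
  refine ⟨ε / (1 + K), ENNReal.div_pos hε.ne' (by finiteness), ENNReal.div_le_of_le_mul ?_, ?_⟩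
  · exact le_mul_of_one_le_right zero_le le_self_add
  · intro a b ha hb
    calc a + K * b < ε / (1 + K) + K * (ε / (1 + K)) :=
          ENNReal.add_lt_add_of_lt_of_le (ENNReal.mul_ne_top (by finiteness) hb.ne_top) ha (by gcongr)
      _ = (1 + K) * (ε / (1 + K)) := by rw [add_mul, one_mul]
      _ = ε := ENNReal.mul_div_cancel (by positivity) (by finiteness)

theorem eLpNorm_cutoff_mul_le {μ : Measure (E d)} {w : E d → ℝ} (h1 : ∀ x, |χ x| ≤ 1) :
    eLpNorm (fun x => χ x * w x) 2 μ ≤ eLpNorm w 2 μ :=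
  eLpNorm_mono fun x => by
    rw [norm_mul]; exact mul_le_of_le_one_left (norm_nonneg _) (h1 x)

theorem eLpNorm_cutoff_smul_add_le {μ : Measure (E d)} {w : E d → ℝ} {K : NNReal}
    (hχ : ContDiff ℝ ((⊤ : ℕ∞) : WithTop ℕ∞) χ)
    (h1 : ∀ x, |χ x| ≤ 1) (hK : ∀ x, ‖gradient χ x‖ ≤ K)
    (hw : AEStronglyMeasurable w μ) (hg : AEStronglyMeasurable g μ) :
    eLpNorm (fun x => χ x • g x + w x • gradient χ x) 2 μ ≤ eLpNorm g 2 μ + K * eLpNorm w 2 μ := by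
  have hgr : Continuous (gradient χ) := by
    simpa [continuousOn_univ] using continuousOn_gradient isOpen_univ hχ.contDiffOn
  refine (eLpNorm_add_le (hχ.continuous.aestronglyMeasurable.smul hg)
    (hw.smul hgr.aestronglyMeasurable) (by norm_num)).trans (add_le_add ?_ ?_)
  · exact eLpNorm_mono fun x => by
      rw [Pi.smul_apply', norm_smul]; exact mul_le_of_le_one_left (norm_nonneg _) (h1 x)
  · refine eLpNorm_le_nnreal_smul_eLpNorm_of_ae_le_mul (.of_forall fun x => ?_) 2
    rw [Pi.smul_apply', nnnorm_smul, mul_comm]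
    gcongr
    exact hK x

section Cutoff

variable {K : NNReal} (hA : IsOpen A) (hχ : ContDiff ℝ ((⊤ : ℕ∞) : WithTop ℕ∞) χ)
  (h1 : ∀ x, |χ x| ≤ 1) (hK : ∀ x, ‖gradient χ x‖ ≤ K)

theorem memLp_cutoff_mul {μ : Measure (E d)} (hχ : Continuous χ) (h1 : ∀ x, |χ x| ≤ 1)
    (hu : MemLp u 2 μ) : MemLp (fun x => χ x * u x) 2 μ :=
  ⟨hχ.aestronglyMeasurable.mul hu.1, (eLpNorm_cutoff_mul_le h1).trans_lt hu.2⟩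

include hχ h1 hK in
theorem memLp_cutoff_gradient {μ : Measure (E d)} (hu : MemLp u 2 μ) (hg : MemLp g 2 μ) :
    MemLp (fun x => χ x • g x + u x • gradient χ x) 2 μ := by
  have hgr : Continuous (gradient χ) := by
    simpa [continuousOn_univ] using continuousOn_gradient isOpen_univ hχ.contDiffOn
  refine ⟨(hχ.continuous.aestronglyMeasurable.smul hg.1).add
    (hu.1.smul hgr.aestronglyMeasurable), ?_⟩
  refine (eLpNorm_cutoff_smul_add_le hχ h1 hK hu.1 hg.1).trans_lt ?_
  have := hu.2
  have := hg.2
  finiteness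

include hA hχ h1 hK in
theorem HasH1Gradient.exists_cutoff_approx (hu : HasH1Gradient A u g) {ε : ℝ≥0∞} (hε : 0 < ε) :
    ∃ f, ContDiffOn ℝ ((⊤ : ℕ∞) : WithTop ℕ∞) f A ∧
      eLpNorm ((fun x => χ x * u x) - fun x => χ x * f x) 2 (volume.restrict A) < ε ∧
      eLpNorm ((fun x => χ x • g x + u x • gradient χ x) - gradient fun x => χ x * f x) 2
        (volume.restrict A) < ε := by
  obtain ⟨δ, hδ, hδε, hδK⟩ := exists_pos_add_mul_lt hε K
  obtain ⟨f, hf, hf1, hf2⟩ := hu.2.2 δ hδ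
  refine ⟨f, hf, ?_, ?_⟩
  · have : ((fun x => χ x * u x) - fun x => χ x * f x) = fun x => χ x * (u - f) x := by
      ext x; simp [mul_sub]
    rw [this]
    exact (eLpNorm_cutoff_mul_le h1).trans_lt (hf1.trans_le hδε)
  · have : ((fun x => χ x • g x + u x • gradient χ x) - gradient fun x => χ x * f x)
        =ᵐ[volume.restrict A] fun x => χ x • (g - gradient f) x + (u - f) x • gradient χ x := by
      filter_upwards [ae_restrict_mem hA.measurableSet] with x hx
      simp only [Pi.sub_apply, gradient_mul (hχ.differentiable (by simp) x)
        (differentiableAt_of_contDiffOn hA hf hx), smul_sub, sub_smul]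
      abel
    rw [eLpNorm_congr_ae this]
    refine (eLpNorm_cutoff_smul_add_le hχ h1 hK
      (hu.1.1.sub (aestronglyMeasurable_of_contDiffOn hA hf))
      (hu.2.1.1.sub (aestronglyMeasurable_gradient hA hf))).trans_lt (hδK _ _ hf2 hf1)

/-- Smoothness of `f` is known only on `A`, but at points outside `A` the product vanishes in a
neighbourhood, the support of `χ` being closed. -/
theorem contDiff_mul_of_tsupport_subset (hA : IsOpen A)
    (hχ : ContDiff ℝ ((⊤ : ℕ∞) : WithTop ℕ∞) χ) (hs : tsupport χ ⊆ A)
    (hf : ContDiffOn ℝ ((⊤ : ℕ∞) : WithTop ℕ∞) f A) :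
    ContDiff ℝ ((⊤ : ℕ∞) : WithTop ℕ∞) (fun x => χ x * f x) := by
  refine contDiff_iff_contDiffAt.2 fun x => ?_
  by_cases hx : x ∈ A
  · exact hχ.contDiffAt.mul (hf.contDiffAt (hA.mem_nhds hx))
  · refine (contDiffAt_const (c := (0 : ℝ))).congr_of_eventuallyEq ?_
    filter_upwards [(isClosed_tsupport χ).isOpen_compl.mem_nhds fun h => hx (hs h)] with y hy
    rw [image_eq_zero_of_notMem_tsupport hy, zero_mul]

include hA hχ h1 hK in
theorem HasH1Gradient.cutoff_mul_h10 (hu : HasH1Gradient A u g) (hc : HasCompactSupport χ)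
    (hs : tsupport χ ⊆ A) :
    HasH10Gradient A (fun x => χ x * u x) (fun x => χ x • g x + u x • gradient χ x) := by
  refine ⟨memLp_cutoff_mul hχ.continuous h1 hu.1, memLp_cutoff_gradient hχ h1 hK hu.1 hu.2.1,
    fun ε hε => ?_⟩
  obtain ⟨f, hf, hf1, hf2⟩ := hu.exists_cutoff_approx hA hχ h1 hK hε
  exact ⟨_, contDiff_mul_of_tsupport_subset hA hχ hs hf, hc.mul_right,
    (tsupport_mul_subset_left).trans hs, hf1, hf2⟩

end Cutoff

/-! ### Extension by zero and translation in `H¹₀` -/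

theorem eLpNorm_indicator_sub_eq {F : Type*} [NormedAddCommGroup F] (hA : MeasurableSet A)
    (hAB : A ⊆ B) {a b : E d → F} (hb : ∀ x ∉ A, b x = 0) :
    eLpNorm (A.indicator a - b) 2 (volume.restrict B) = eLpNorm (a - b) 2 (volume.restrict A) := by
  have : A.indicator a - b = A.indicator (a - b) := by
    ext x
    by_cases hx : x ∈ A <;> simp [hx, hb]
  rw [this, eLpNorm_indicator_eq_eLpNorm_restrict hA, Measure.restrict_restrict hA,
    inter_eq_left.2 hAB]

/-- The approximants are globally defined and supported in `A`, so the same ones serve on `B`. -/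
theorem HasH10Gradient.extend_zero (hA : IsOpen A) (hAB : A ⊆ B) (h : HasH10Gradient A v g) :
    HasH10Gradient B (A.indicator v) (A.indicator g) := by
  have hm : volume.restrict A = (volume.restrict B).restrict A := by
    rw [Measure.restrict_restrict hA.measurableSet, inter_eq_left.2 hAB]
  refine ⟨?_, ?_, fun ε hε => ?_⟩
  · rw [memLp_indicator_iff_restrict hA.measurableSet, ← hm]; exact h.1
  · rw [memLp_indicator_iff_restrict hA.measurableSet, ← hm]; exact h.2.1
  · obtain ⟨f, hf, hc, hs, h1, h2⟩ := h.2.2 ε hε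
    refine ⟨f, hf, hc, hs.trans hAB, ?_, ?_⟩
    · rwa [eLpNorm_indicator_sub_eq hA.measurableSet hAB
        fun x hx => image_eq_zero_of_notMem_tsupport fun h => hx (hs h)]
    · rwa [eLpNorm_indicator_sub_eq hA.measurableSet hAB
        fun x hx => gradient_eq_zero_of_notMem_tsupport fun h => hx (hs h)]

theorem measurePreserving_sub_restrict (A : Set (E d)) (z : E d) :
    MeasurePreserving (fun x => x - z) (volume.restrict ((fun x => x - z) ⁻¹' A))
      (volume.restrict A) :=
  (measurePreserving_sub_right volume z).restrict_preimage_emb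
    (MeasurableEquiv.subRight z).measurableEmbedding A

theorem HasH10Gradient.translate (h : HasH10Gradient A v g) (z : E d) :
    HasH10Gradient ((fun x => x - z) ⁻¹' A) (fun x => v (x - z)) (fun x => g (x - z)) := by
  have hm := measurePreserving_sub_restrict A z
  have he := (MeasurableEquiv.subRight z).measurableEmbedding
  have hL : ∀ {F : Type} [NormedAddCommGroup F] (a : E d → F),
      eLpNorm (fun x => a (x - z)) 2 (volume.restrict ((fun x => x - z) ⁻¹' A)) =
      eLpNorm a 2 (volume.restrict A) := fun a => by
    rw [← hm.map_eq]
    exact (he.eLpNorm_map_measure (f := fun x => x - z)).symm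
  refine ⟨h.1.comp_measurePreserving hm, h.2.1.comp_measurePreserving hm, fun ε hε => ?_⟩
  obtain ⟨f, hf, hc, hs, h1, h2⟩ := h.2.2 ε hε
  refine ⟨fun x => f (x - z), hf.comp (contDiff_id.sub contDiff_const),
    hc.comp_homeomorph (Homeomorph.subRight z), ?_, ?_, ?_⟩
  · exact (tsupport_comp_subset_preimage f (by fun_prop : Continuous fun x : E d => x - z)).trans
      (preimage_mono hs)
  · rw [← hL] at h1; exact h1
  · rw [← hL] at h2
    refine lt_of_eq_of_lt ?_ h2
    congr 1
    ext1 x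
    simp [gradient, fderiv_comp_sub]


/-! ### Uniqueness of the weak gradient -/

section Unique

variable {d : ℕ} {A : Set (E d)} {u f ψ : E d → ℝ} {g k : E d → E d}

theorem continuous_gradient (hf : ContDiff ℝ ((⊤ : ℕ∞) : WithTop ℕ∞) f) :
    Continuous (gradient f) := by
  simpa [continuousOn_univ] using continuousOn_gradient isOpen_univ hf.contDiffOn

theorem hasCompactSupport_gradient (hf : HasCompactSupport f) :
    HasCompactSupport (gradient f) :=
  HasCompactSupport.intro hf fun _ hx => gradient_eq_zero_of_notMem_tsupport hx

theorem integral_gradient_eq_zero (hf : ContDiff ℝ ((⊤ : ℕ∞) : WithTop ℕ∞) f)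
    (hc : HasCompactSupport f) : ∫ x, gradient f x = 0 := by
  have hi : Integrable (gradient f) :=
    (continuous_gradient hf).integrable_of_hasCompactSupport (hasCompactSupport_gradient hc)
  refine ext_inner_right ℝ fun v => ?_
  rw [inner_zero_left, real_inner_comm, ← integral_inner hi]
  have h := integral_mul_fderiv_eq_neg_fderiv_mul_of_integrable (μ := (volume : Measure (E d)))
    (f := fun _ => (1 : ℝ)) (g := f) (v := v) (by simp) ?_ ?_ (by simp)
    (fun x _ => hf.differentiable (by simp) x)
  · simpa [real_inner_comm v, inner_gradient_left] using h
  · simp only [one_mul]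
    refine (hi.inner_const v).congr (.of_forall fun x => ?_)
    simp [inner_gradient_left]
  · simpa using hf.continuous.integrable_of_hasCompactSupport hc

/-- Closability of the gradient. For approximants f → 0 with Df → k and a test function ψ,
integration by parts gives ∫ ψ Df = -∫ f Dψ → 0, so k is orthogonal to all test functions. -/
theorem HasH1Gradient.ae_eq_zero (hA : IsOpen A) (h : HasH1Gradient A 0 k) :
    k =ᵐ[volume.restrict A] 0 := by
  have hloc : LocallyIntegrableOn k A := by
    exact locallyIntegrableOn_of_locallyIntegrable_restrict (h.2.1.locallyIntegrable (by norm_num))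
  have key := hA.ae_eq_zero_of_integral_contDiff_smul_eq_zero hloc fun ψ hψ hψc hψA => ?_
  · rw [Filter.EventuallyEq, ae_restrict_iff' hA.measurableSet]; exact key
  have hψ2 : MemLp ψ 2 (volume.restrict A) := hψ.continuous.memLp_of_hasCompactSupport hψc
  have hgψ2 : MemLp (gradient ψ) 2 (volume.restrict A) :=
    (continuous_gradient hψ).memLp_of_hasCompactSupport (hasCompactSupport_gradient hψc)
  have hrestr : ∫ x, ψ x • k x = ∫ x in A, ψ x • k x := by
    refine (setIntegral_eq_integral_of_forall_compl_eq_zero fun x hx => ?_).symm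
    rw [image_eq_zero_of_notMem_tsupport fun h => hx (hψA h), zero_smul]
  rw [hrestr]
  by_contra hne
  set M : ℝ≥0∞ := eLpNorm ψ 2 (volume.restrict A) + eLpNorm (gradient ψ) 2 (volume.restrict A)
  have hM : M ≠ ⊤ := ENNReal.add_ne_top.2 ⟨hψ2.2.ne, hgψ2.2.ne⟩
  obtain ⟨δ, hδ, -, hδM⟩ := exists_pos_add_mul_lt (enorm_pos.2 hne) M.toNNReal
  obtain ⟨f, hf, hf1, hf2⟩ := h.2.2 δ hδ
  have hfm := aestronglyMeasurable_of_contDiffOn hA hf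
  have hgm := aestronglyMeasurable_gradient hA hf
  have hF := contDiff_mul_of_tsupport_subset hA hψ hψA hf
  have hFc : HasCompactSupport fun x => ψ x * f x := hψc.mul_right
  have hF0 : ∫ x in A, gradient (fun x => ψ x * f x) x = 0 := by
    rw [setIntegral_eq_integral_of_forall_compl_eq_zero, integral_gradient_eq_zero hF hFc]
    exact fun x hx => gradient_eq_zero_of_notMem_tsupport fun h =>
      hx (hψA (tsupport_mul_subset_left h))
  have hi1 : Integrable (fun x => ψ x • k x) (volume.restrict A) :=
    memLp_one_iff_integrable.1 (h.2.1.smul hψ2)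
  have hi2 : Integrable (gradient fun x => ψ x * f x) (volume.restrict A) :=
    ((continuous_gradient hF).integrable_of_hasCompactSupport
      (hasCompactSupport_gradient hFc)).integrableOn
  -- Subtract the vanishing integral of D(ψ f) = ψ Df + f Dψ and apply Hölder to both remaining
  -- terms.
  have hle : ‖∫ x in A, ψ x • k x‖ₑ ≤ M * max (eLpNorm (0 - f) 2 (volume.restrict A))
      (eLpNorm (k - gradient f) 2 (volume.restrict A)) := by
    calc ‖∫ x in A, ψ x • k x‖ₑ
        = ‖∫ x in A, (ψ x • k x - gradient (fun x => ψ x * f x) x)‖ₑ := by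
          rw [integral_sub hi1 hi2, hF0, sub_zero]
      _ = ‖∫ x in A, (ψ • (k - gradient f) + (0 - f) • gradient ψ) x‖ₑ := by
          congr 1
          refine integral_congr_ae ?_
          filter_upwards [ae_restrict_mem hA.measurableSet] with x hx
          rw [gradient_mul (hψ.differentiable (by simp) x) (differentiableAt_of_contDiffOn hA hf hx)]
          simp only [Pi.add_apply, Pi.smul_apply', Pi.sub_apply, smul_sub, zero_sub, Pi.neg_apply,
            neg_smul]
          abel
      _ ≤ eLpNorm (ψ • (k - gradient f) + (0 - f) • gradient ψ) 1 (volume.restrict A) := by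
          rw [eLpNorm_one_eq_lintegral_enorm]
          exact enorm_integral_le_lintegral_enorm _
      _ ≤ eLpNorm (ψ • (k - gradient f)) 1 (volume.restrict A) +
          eLpNorm ((0 - f) • gradient ψ) 1 (volume.restrict A) :=
          eLpNorm_add_le (hψ2.1.smul (h.2.1.1.sub hgm))
            ((aestronglyMeasurable_zero.sub hfm).smul hgψ2.1) le_rfl
      _ ≤ eLpNorm ψ 2 (volume.restrict A) * eLpNorm (k - gradient f) 2 (volume.restrict A) +
          eLpNorm (0 - f) 2 (volume.restrict A) * eLpNorm (gradient ψ) 2 (volume.restrict A) :=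
          add_le_add (eLpNorm_smul_le_mul_eLpNorm (h.2.1.1.sub hgm) hψ2.1)
            (eLpNorm_smul_le_mul_eLpNorm hgψ2.1 (aestronglyMeasurable_zero.sub hfm))
      _ ≤ _ := by
          rw [mul_comm (eLpNorm (0 - f) 2 _), add_mul]
          gcongr
          · exact le_max_right _ _
          · exact le_max_left _ _
  have := hδM 0 _ hδ (max_lt hf1 hf2)
  rw [zero_add, ENNReal.coe_toNNReal hM] at this
  exact (hle.trans_lt this).false

/-- Needed for gluing: the `g` entering the energy and the gradient behind the `H¹₀` boundary
condition are a priori unrelated. -/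
theorem HasH1Gradient.ae_eq (hA : IsOpen A) (h : HasH1Gradient A u g) (h' : HasH1Gradient A u k) :
    g =ᵐ[volume.restrict A] k := by
  have := (h.add hA h'.neg)
  rw [add_neg_cancel] at this
  filter_upwards [this.ae_eq_zero hA] with x hx
  simpa [← sub_eq_add_neg, sub_eq_zero] using hx

end Unique

/-! ### Boxes and cutoff functions -/

section Box

variable {n d : ℕ}

/-- The open box with half side lengths `r i` along the orthonormal basis `c`. -/
def box (c : OrthonormalBasis (Fin (n + 1)) ℝ (E d)) (r : Fin (n + 1) → ℝ) : Set (E d) :=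
  {y | ∀ i, |inner ℝ y (c i)| < r i}

variable (c : OrthonormalBasis (Fin (n + 1)) ℝ (E d))

theorem isOpen_box (r : Fin (n + 1) → ℝ) : IsOpen (box c r) := by
  simp only [box, ofPred_forall]
  exact isOpen_iInter_of_finite fun i => isOpen_lt (by fun_prop) continuous_const

theorem norm_le_sum_abs_inner (y : E d) : ‖y‖ ≤ ∑ i, |inner ℝ y (c i)| := by
  conv_lhs => rw [← c.sum_repr' y]
  refine (norm_sum_le _ _).trans (Finset.sum_le_sum fun i _ => ?_)
  rw [norm_smul, c.norm_eq_one, mul_one, Real.norm_eq_abs, real_inner_comm]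

theorem isCompact_closed_box (r : Fin (n + 1) → ℝ) :
    IsCompact {y : E d | ∀ i, |inner ℝ y (c i)| ≤ r i} := by
  refine Metric.isCompact_of_isClosed_isBounded ?_ ?_
  · simp only [ofPred_forall]
    exact isClosed_iInter fun i => isClosed_le (by fun_prop) continuous_const
  · refine (Metric.isBounded_closedBall (x := (0 : E d)) (r := ∑ i, r i)).subset fun y hy => ?_
    rw [mem_closedBall_zero_iff]
    exact (norm_le_sum_abs_inner c y).trans (Finset.sum_le_sum fun i _ => hy i)

/-- The derivative is continuous and vanishes outside the compact interval [0, 1], hence is bounded.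
-/
theorem exists_lipschitzWith_smoothTransition : ∃ K, LipschitzWith K Real.smoothTransition := by
  have hs : ContDiff ℝ 1 Real.smoothTransition := Real.smoothTransition.contDiff
  obtain ⟨C, hC⟩ := (isCompact_Icc (a := (0 : ℝ)) (b := 1)).exists_bound_of_continuousOn
    (hs.continuous_deriv le_rfl).continuousOn
  refine ⟨C.toNNReal, lipschitzWith_of_nnnorm_deriv_le (hs.differentiable (by simp)) fun x => ?_⟩
  rw [← NNReal.coe_le_coe, coe_nnnorm]
  refine le_trans ?_ (Real.le_coe_toNNReal C)
  have hC0 : 0 ≤ C := (norm_nonneg _).trans (hC 0 (by simp))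
  rcases lt_or_ge x 0 with hx | hx
  · have : Real.smoothTransition =ᶠ[𝓝 x] fun _ => 0 := by
      filter_upwards [gt_mem_nhds hx] with y hy using Real.smoothTransition.zero_of_nonpos hy.le
    rw [this.deriv_eq]; simp [hC0]
  rcases lt_or_ge 1 x with hx' | hx'
  · have : Real.smoothTransition =ᶠ[𝓝 x] fun _ => 1 := by
      filter_upwards [lt_mem_nhds hx'] with y hy using Real.smoothTransition.one_of_one_le hy.le
    rw [this.deriv_eq]; simp [hC0]
  · exact hC x ⟨hx, hx'⟩

theorem LipschitzWith.mul_of_mem_unit {X : Type*} [PseudoMetricSpace X] {f g : X → ℝ}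
    {K L : NNReal} (hf : LipschitzWith K f) (hg : LipschitzWith L g)
    (hf1 : ∀ x, f x ∈ Icc (0 : ℝ) 1) (hg1 : ∀ x, g x ∈ Icc (0 : ℝ) 1) :
    LipschitzWith (K + L) fun x => f x * g x := by
  refine LipschitzWith.of_dist_le_mul fun x y => ?_
  have h1 := hf.dist_le_mul x y
  have h2 := hg.dist_le_mul x y
  rw [Real.dist_eq] at *
  have : f x * g x - f y * g y = (f x - f y) * g x + f y * (g x - g y) := by ring
  rw [this]
  refine (abs_add_le _ _).trans ?_
  rw [abs_mul, abs_mul, abs_of_nonneg (hg1 x).1, abs_of_nonneg (hf1 y).1]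
  push_cast
  nlinarith [abs_nonneg (f x - f y), abs_nonneg (g x - g y), (hg1 x).2, (hf1 y).2]

theorem LipschitzWith.prod_of_mem_unit {X ι : Type*} [PseudoMetricSpace X] {f : ι → X → ℝ}
    {K : NNReal} (hf : ∀ i, LipschitzWith K (f i)) (hf1 : ∀ i x, f i x ∈ Icc (0 : ℝ) 1)
    (s : Finset ι) : LipschitzWith (s.card * K) fun x => ∏ i ∈ s, f i x := by
  classical
  induction s using Finset.induction_on with
  | empty => simp
  | insert a s ha ih =>
    simp only [Finset.prod_insert ha, Finset.card_insert_of_notMem ha]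
    have := LipschitzWith.mul_of_mem_unit (hf a) ih (hf1 a) fun x =>
      ⟨Finset.prod_nonneg fun i _ => (hf1 i x).1, Finset.prod_le_one (fun i _ => (hf1 i x).1)
        fun i _ => (hf1 i x).2⟩
    refine this.weaken (le_of_eq ?_)
    push_cast; ring

/-- Cutoff functions between boxes at distance one, with a gradient bound that does not depend on
the size of the boxes. -/
theorem exists_cutoff : ∃ K : NNReal, ∀ r : Fin (n + 1) → ℝ, ∃ χ : E d → ℝ,
    ContDiff ℝ ((⊤ : ℕ∞) : WithTop ℕ∞) χ ∧ (∀ y, χ y ∈ Icc (0 : ℝ) 1) ∧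
    (∀ y, ‖gradient χ y‖ ≤ K) ∧ (∀ y, (∀ i, |inner ℝ y (c i)| ≤ r i) → χ y = 1) ∧
    tsupport χ ⊆ {y | ∀ i, |inner ℝ y (c i)| ≤ r i + 1} := by
  obtain ⟨L, hL⟩ := exists_lipschitzWith_smoothTransition
  have hst : ∀ s, Real.smoothTransition s ∈ Icc (0 : ℝ) 1 := fun s =>
    ⟨Real.smoothTransition.nonneg s, Real.smoothTransition.le_one s⟩
  -- The cutoff is a product of n + 1 factors with values in [0, 1], each a product of two
  -- `L`-Lipschitz transitions. The transitions have width one whatever `r` is, hence the uniform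
  -- bound.
  refine ⟨((Finset.univ : Finset (Fin (n + 1))).card : NNReal) * (L + L), fun r => ?_⟩
  let η : Fin (n + 1) → E d → ℝ := fun i y =>
    Real.smoothTransition (r i + 1 - inner ℝ y (c i)) *
      Real.smoothTransition (r i + 1 + inner ℝ y (c i))
  have hinner : ∀ i, LipschitzWith 1 fun y : E d => inner ℝ y (c i) := fun i =>
    LipschitzWith.of_dist_le_mul fun x y => by
      rw [Real.dist_eq, ← inner_sub_left, dist_eq_norm]
      simpa using abs_real_inner_le_norm (x - y) (c i)
  have hη1 : ∀ i y, η i y ∈ Icc (0 : ℝ) 1 := fun i y =>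
    ⟨mul_nonneg (hst _).1 (hst _).1, mul_le_one₀ (hst _).2 (hst _).1 (hst _).2⟩
  have hηL : ∀ i, LipschitzWith (L + L) (η i) := fun i => by
    refine LipschitzWith.mul_of_mem_unit ?_ ?_ (fun _ => hst _) (fun _ => hst _)
    · have : LipschitzWith 1 fun y : E d => r i + 1 - inner ℝ y (c i) := by
        simpa using (LipschitzWith.const (r i + 1)).sub (hinner i)
      rw [← mul_one L]; exact hL.comp this
    · have : LipschitzWith 1 fun y : E d => r i + 1 + inner ℝ y (c i) := by
        simpa using (LipschitzWith.const (r i + 1)).add (hinner i)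
      rw [← mul_one L]; exact hL.comp this
  refine ⟨fun y => ∏ i, η i y, ?_, fun y => ⟨Finset.prod_nonneg fun i _ => (hη1 i y).1,
    Finset.prod_le_one (fun i _ => (hη1 i y).1) fun i _ => (hη1 i y).2⟩, fun y => ?_, fun y hy => ?_,
    ?_⟩
  · refine contDiff_prod fun i _ => ContDiff.mul ?_ ?_
    · exact Real.smoothTransition.contDiff.comp
        (contDiff_const.sub (contDiff_id.inner ℝ contDiff_const))
    · exact Real.smoothTransition.contDiff.comp
        (contDiff_const.add (contDiff_id.inner ℝ contDiff_const))
  · rw [norm_gradient]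
    exact norm_fderiv_le_of_lipschitz ℝ (LipschitzWith.prod_of_mem_unit hηL hη1 _)
  · refine Finset.prod_eq_one fun i _ => ?_
    have := abs_le.1 (hy i)
    simp only [η]
    rw [Real.smoothTransition.one_of_one_le (by linarith),
      Real.smoothTransition.one_of_one_le (by linarith), one_mul]
  · refine closure_minimal (fun y hy i => ?_) (isCompact_closed_box c fun i => r i + 1).isClosed
    by_contra hlt
    refine hy (Finset.prod_eq_zero (Finset.mem_univ i) ?_)
    rw [not_le, lt_abs] at hlt
    rcases hlt with h | h
    · simp only [η]
      rw [Real.smoothTransition.zero_of_nonpos (by linarith), zero_mul]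
    · simp only [η]
      rw [Real.smoothTransition.zero_of_nonpos (x := r i + 1 + _) (by linarith), mul_zero]

/-! ### Integration along the coordinate axes -/

theorem measurePreserving_coordinates :
    MeasurePreserving (fun y : E d =>
      ((inner ℝ y (c 0), fun i : Fin n => inner ℝ y (c i.succ)) : ℝ × (Fin n → ℝ))) := by
  have h := ((volume_preserving_piFinSuccAbove (fun _ : Fin (n + 1) => ℝ) 0).comp
    (PiLp.volume_preserving_ofLp (Fin (n + 1)))).comp c.measurePreserving_repr
  refine (congrArg (fun F => MeasurePreserving F volume volume) (funext fun y => ?_)).mp h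
  refine Prod.ext ?_ (funext fun i => ?_)
  · change c.repr y 0 = _
    rw [c.repr_apply_apply, real_inner_comm]
  · change c.repr y i.succ = _
    rw [c.repr_apply_apply, real_inner_comm]

/-- In coordinates along `c`, the set `A` lies in the product of `S` and `T`, and the first marginal
of Lebesgue measure on that product is the right-hand side. -/
theorem map_inner_restrict_le {A : Set (E d)} {S : Set ℝ} {T : Set (Fin n → ℝ)}
    (hS : MeasurableSet S) (hT : MeasurableSet T)
    (hA : ∀ y ∈ A, inner ℝ y (c 0) ∈ S ∧ (fun i : Fin n => inner ℝ y (c i.succ)) ∈ T) :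
    Measure.map (fun y : E d => inner ℝ y (c 0)) (volume.restrict A) ≤
      volume T • volume.restrict S := by
  refine Measure.le_iff.2 fun s hs => ?_
  have hm : Measurable fun y : E d => inner ℝ y (c 0) := by fun_prop
  rw [Measure.map_apply hm hs, Measure.restrict_apply (hm hs), Measure.smul_apply,
    Measure.restrict_apply hs, smul_eq_mul, mul_comm, ← Measure.prod_prod, ← Measure.volume_eq_prod,
    ← (measurePreserving_coordinates c).measure_preimage ((hs.inter hS).prod hT).nullMeasurableSet]
  exact measure_mono fun y hy => ⟨⟨hy.1, (hA y hy.2).1⟩, (hA y hy.2).2⟩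

theorem setLIntegral_inner_le {A : Set (E d)} {S : Set ℝ} {T : Set (Fin n → ℝ)}
    (hS : MeasurableSet S) (hT : MeasurableSet T)
    (hA : ∀ y ∈ A, inner ℝ y (c 0) ∈ S ∧ (fun i : Fin n => inner ℝ y (c i.succ)) ∈ T)
    {F : ℝ → ℝ≥0∞} (hF : Measurable F) :
    ∫⁻ y in A, F (inner ℝ y (c 0)) ≤ volume T * ∫⁻ t in S, F t := by
  rw [← lintegral_map hF (by fun_prop : Measurable fun y : E d => inner ℝ y (c 0))]
  refine (lintegral_mono' (map_inner_restrict_le c hS hT hA) le_rfl).trans ?_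
  rw [lintegral_smul_measure, smul_eq_mul]

end Box


/-! ### One-dimensional profiles -/

section Profile

variable {Lam : ℝ} {W q q₁ q₂ : ℝ → ℝ}

theorem IsProfile.continuous (hq : IsProfile Lam W q) : Continuous q := by
  refine continuous_iff_continuousAt.2 fun t => ?_
  refine (hq.absCont (t - 1) (t + 1)).continuousOn.continuousAt ?_
  rw [uIcc_of_le (by linarith)]
  exact Icc_mem_nhds (by linarith) (by linarith)

theorem IsProfile.continuous_potential (hW : IsDoubleWell W) (hq : IsProfile Lam W q) :
    Continuous fun s => W (q s) :=
  hW.continuousOn.comp_continuous hq.continuous hq.mem_Icc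

theorem IsProfile.integrable_sq_deriv (hLam : 0 < Lam) (hW : IsDoubleWell W)
    (hq : IsProfile Lam W q) : Integrable fun s => deriv q s ^ 2 := by
  refine (hq.finite_energy.const_mul (2 / Lam)).mono'
    ((measurable_deriv q).pow_const 2).aestronglyMeasurable (.of_forall fun s => ?_)
  have := hW.nonneg _ (hq.mem_Icc s)
  have h2 : 2 / Lam * (Lam / 2 * deriv q s ^ 2 + W (q s)) =
    deriv q s ^ 2 + 2 / Lam * W (q s) := by field_simp
  rw [h2, Real.norm_of_nonneg (sq_nonneg _)]
  have : 0 ≤ 2 / Lam * W (q s) := by positivity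
  linarith

theorem IsProfile.memLp_deriv (hLam : 0 < Lam) (hW : IsDoubleWell W)
    (hq : IsProfile Lam W q) : MemLp (deriv q) 2 :=
  (memLp_two_iff_integrable_sq (measurable_deriv q).aestronglyMeasurable).2
    (hq.integrable_sq_deriv hLam hW)

theorem enorm_intervalIntegral_le {f : ℝ → ℝ} {ρ t : ℝ} (ht : t ∈ Ioo (-ρ) ρ) :
    ‖∫ s in (0 : ℝ)..t, f s‖ₑ ≤ ∫⁻ s in Ioo (-ρ) ρ, ‖f s‖ₑ := by
  have hsub : uIoc 0 t ⊆ Ioo (-ρ) ρ := by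
    intro s hs
    rcases le_total 0 t with h | h
    · rw [uIoc_of_le h] at hs; exact ⟨by linarith [hs.1, ht.1, ht.2], by linarith [hs.2, ht.2]⟩
    · rw [uIoc_of_ge h] at hs; exact ⟨by linarith [hs.1, ht.1], by linarith [hs.2, ht.1, ht.2]⟩
  rw [← ofReal_norm, intervalIntegral.norm_intervalIntegral_eq, ofReal_norm]
  exact (enorm_integral_le_lintegral_enorm _).trans (lintegral_mono_set hsub)

/-- Approximate q' in L² by a smooth p and integrate p from 0, starting at q(0). On a bounded
interval the L² error of the derivative controls the uniform error of the function. -/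
theorem IsProfile.exists_smooth_approx (hLam : 0 < Lam) (hW : IsDoubleWell W)
    (hq : IsProfile Lam W q) (ρ : ℝ) {ε : ℝ≥0∞} (hε : 0 < ε) :
    ∃ Q : ℝ → ℝ, ContDiff ℝ ((⊤ : ℕ∞) : WithTop ℕ∞) Q ∧
      eLpNorm (q - Q) 2 (volume.restrict (Ioo (-ρ) ρ)) < ε ∧
      eLpNorm (deriv q - deriv Q) 2 (volume.restrict (Ioo (-ρ) ρ)) < ε := by
  set ν : Measure ℝ := volume.restrict (Ioo (-ρ) ρ) with hν
  have hq' := hq.memLp_deriv hLam hW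
  -- The first factor comes from Cauchy–Schwarz (L¹ by L²), the second is the L² norm of the
  -- constant 1.
  set K : ℝ≥0∞ := ν univ ^ (1 / (1 : ℝ≥0∞).toReal - 1 / (2 : ℝ≥0∞).toReal) *
    ν univ ^ ((2 : ℝ≥0∞).toReal)⁻¹ with hKdef
  have hνfin : ν univ ≠ ⊤ := measure_ne_top _ _
  have hK : K ≠ ⊤ := ENNReal.mul_ne_top (ENNReal.rpow_ne_top_of_nonneg (by norm_num) hνfin)
    (ENNReal.rpow_ne_top_of_nonneg (by norm_num) hνfin)
  obtain ⟨δ, hδ, hδε, hδK⟩ := exists_pos_add_mul_lt hε K.toNNReal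
  obtain ⟨δ', hδ', hδ'δ⟩ : ∃ δ' : ℝ, 0 < δ' ∧ ENNReal.ofReal δ' < δ := by
    obtain ⟨r, hr0, hr⟩ := ENNReal.lt_iff_exists_nnreal_btwn.1 hδ
    exact ⟨r, by exact_mod_cast hr0, by simpa using hr⟩
  obtain ⟨p, hpc, hp, hpq⟩ := hq'.exist_eLpNorm_sub_le (by norm_num) (by norm_num) hδ'
  have hpi : ∀ a b, IntervalIntegrable p volume a b := fun a b => hp.continuous.intervalIntegrable a b
  let Q : ℝ → ℝ := fun t => q 0 + ∫ s in (0 : ℝ)..t, p s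
  have hQd : ∀ t, HasDerivAt Q (p t) t := fun t =>
    (intervalIntegral.integral_hasDerivAt_right (hpi 0 t)
      (hp.continuous.stronglyMeasurableAtFilter _ _) hp.continuous.continuousAt).const_add _
  have hQ' : deriv Q = p := funext fun t => (hQd t).deriv
  have hQs : ContDiff ℝ ((⊤ : ℕ∞) : WithTop ℕ∞) Q := by
    rw [contDiff_infty_iff_deriv, hQ']
    exact ⟨fun t => (hQd t).differentiableAt, hp⟩
  have hder : eLpNorm (deriv q - deriv Q) 2 ν < δ := by
    rw [hQ']
    exact ((eLpNorm_mono_measure _ Measure.restrict_le_self).trans hpq).trans_lt hδ'δ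
  refine ⟨Q, hQs, ?_, hder.trans_le hδε⟩
  have hm : AEStronglyMeasurable (deriv q - deriv Q) ν :=
    ((measurable_deriv q).sub (measurable_deriv Q)).aestronglyMeasurable
  have hsup : ∀ t ∈ Ioo (-ρ) ρ, ‖(q - Q) t‖ₑ ≤ eLpNorm (deriv q - deriv Q) 1 ν := by
    intro t ht
    have : (q - Q) t = ∫ s in (0 : ℝ)..t, (deriv q - deriv Q) s := by
      have h1 := (hq.absCont 0 t).integral_deriv_eq_sub
      simp only [Pi.sub_apply]
      rw [intervalIntegral.integral_sub (hq.absCont 0 t).intervalIntegrable_deriv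
        (by rw [hQ']; exact hpi 0 t), h1, hQ']
      simp only [Q]; ring
    rw [this, eLpNorm_one_eq_lintegral_enorm]
    exact enorm_intervalIntegral_le ht
  have hle : eLpNorm (q - Q) 2 ν ≤ K * eLpNorm (deriv q - deriv Q) 2 ν := by
    calc eLpNorm (q - Q) 2 ν
        ≤ eLpNorm (fun _ : ℝ => eLpNorm (deriv q - deriv Q) 1 ν) 2 ν := by
          refine eLpNorm_mono_enorm_ae ?_
          filter_upwards [ae_restrict_mem measurableSet_Ioo] with t ht
          simpa using hsup t ht
      _ ≤ eLpNorm (deriv q - deriv Q) 1 ν * ν univ ^ ((2 : ℝ≥0∞).toReal)⁻¹ := by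
          rcases eq_or_ne ν 0 with h0 | h0
          · simp [h0]
          rw [eLpNorm_const _ (by norm_num) h0, enorm_eq_self, one_div]
      _ ≤ _ := by
          have := eLpNorm_le_eLpNorm_mul_rpow_measure_univ (μ := ν) (p := 1) (q := 2)
            (by norm_num) hm
          rw [hKdef, mul_right_comm]
          rw [mul_comm (eLpNorm (deriv q - deriv Q) 2 ν)] at this
          gcongr
  have := hδK 0 _ hδ hder
  rw [zero_add, ENNReal.coe_toNNReal hK] at this
  exact hle.trans_lt this

/-- A piecewise affine profile. -/
theorem exists_isProfile (hW : IsDoubleWell W) : ∃ q, IsProfile Lam W q := by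
  have hlip : LipschitzWith 1 fun s : ℝ => max (-1) (min 1 s) :=
    (LipschitzWith.id.const_min 1).const_max (-1)
  have hm : ∀ s : ℝ, max (-1) (min 1 s) ∈ Icc (-1 : ℝ) 1 := fun s => by simp
  have hgt : ∀ s : ℝ, 1 ≤ s → max (-1) (min 1 s) = 1 := fun s hs => by
    rw [min_eq_left hs]; norm_num
  have hlt : ∀ s : ℝ, s ≤ -1 → max (-1) (min 1 s) = -1 := fun s hs => by
    rw [min_eq_right (by linarith)]; exact max_eq_left hs
  refine ⟨fun s => max (-1) (min 1 s), hm, fun a b =>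
    (hlip.lipschitzOnWith).absolutelyContinuousOnInterval, ?_, ?_, ?_⟩
  · have hWc : Continuous fun s : ℝ => W (max (-1) (min 1 s)) :=
      hW.continuousOn.comp_continuous hlip.continuous hm
    obtain ⟨C, hC⟩ := isCompact_Icc.exists_bound_of_continuousOn hW.continuousOn
    have hi : IntegrableOn (fun s : ℝ => Lam / 2 * deriv (fun s : ℝ => max (-1) (min 1 s)) s ^ 2 +
        W (max (-1) (min 1 s))) (Icc (-1) 1) := by
      refine Measure.integrableOn_of_bounded (M := |Lam / 2| + C) (by simp) ?_ (.of_forall fun s => ?_)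
      · exact ((((measurable_deriv _).pow_const 2).const_mul _).add
          hWc.measurable).aestronglyMeasurable
      · refine (norm_add_le _ _).trans (add_le_add ?_ (hC _ (hm s)))
        rw [norm_mul, norm_pow]
        refine mul_le_of_le_one_right (abs_nonneg _) (pow_le_one₀ (norm_nonneg _) ?_)
        simpa using norm_deriv_le_of_lipschitz (x₀ := s) hlip
    rw [← integrableOn_iff_integrable_of_support_subset (s := Icc (-1) 1)]
    · exact hi
    · intro s hs
      by_contra hns
      refine hs ?_
      have : s < -1 ∨ 1 < s := by
        by_contra! h; exact hns h
      rcases this with h | h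
      · have he : (fun s : ℝ => max (-1) (min 1 s)) =ᶠ[𝓝 s] fun _ => (-1 : ℝ) := by
          filter_upwards [gt_mem_nhds h] with r hr using hlt r hr.le
        simp only [he.deriv_eq, hlt s h.le, (hW.zero_iff (-1) (by simp)).2 (Or.inl rfl)]
        simp
      · have he : (fun s : ℝ => max (-1) (min 1 s)) =ᶠ[𝓝 s] fun _ => (1 : ℝ) := by
          filter_upwards [lt_mem_nhds h] with r hr using hgt r hr.le
        simp only [he.deriv_eq, hgt s h.le, (hW.zero_iff 1 (by simp)).2 (Or.inr rfl)]
        simp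
  · exact tendsto_const_nhds.congr' (by filter_upwards [eventually_ge_atTop 1] with s hs using
      (hgt s hs).symm)
  · exact tendsto_const_nhds.congr' (by filter_upwards [eventually_le_atBot (-1)] with s hs using
      (hlt s hs).symm)

theorem convexComb_mem_Icc {a b θ : ℝ} (ha : a ∈ Icc (-1 : ℝ) 1) (hb : b ∈ Icc (-1 : ℝ) 1)
    (hθ : θ ∈ Icc (0 : ℝ) 1) : θ * a + (1 - θ) * b ∈ Icc (-1 : ℝ) 1 :=
  convex_Icc (-1 : ℝ) 1 ha hb hθ.1 (by linarith [hθ.2]) (by ring)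

/-- Both functions end up in a small ball around the well `s₀`. Balls are convex, so all
interpolations stay there too, uniformly in θ. -/
theorem eventually_interpolation_le (hW : IsDoubleWell W) {l : Filter ℝ} {s₀ : ℝ}
    (hs₀ : s₀ ∈ Icc (-1 : ℝ) 1) (h0 : W s₀ = 0) {f₁ f₂ : ℝ → ℝ}
    (h₁ : Tendsto f₁ l (𝓝 s₀)) (h₂ : Tendsto f₂ l (𝓝 s₀))
    (hm₁ : ∀ t, f₁ t ∈ Icc (-1 : ℝ) 1) (hm₂ : ∀ t, f₂ t ∈ Icc (-1 : ℝ) 1) {ε : ℝ} (hε : 0 < ε) :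
    ∀ᶠ t in l, (f₁ t - f₂ t) ^ 2 ≤ ε ∧
      ∀ θ ∈ Icc (0 : ℝ) 1, W (θ * f₁ t + (1 - θ) * f₂ t) ≤ ε := by
  have hsq : Tendsto (fun t => (f₁ t - f₂ t) ^ 2) l (𝓝 0) := by
    simpa using (h₁.sub h₂).pow 2
  obtain ⟨δ, hδ, hδW⟩ := Metric.continuousWithinAt_iff.1 (hW.continuousOn s₀ hs₀) ε hε
  filter_upwards [hsq.eventually_le_const hε, h₁ (Metric.ball_mem_nhds s₀ hδ),
    h₂ (Metric.ball_mem_nhds s₀ hδ)] with t ht1 ht2 ht3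
  refine ⟨ht1, fun θ hθ => ?_⟩
  have hball := (convex_ball s₀ δ) ht2 ht3 hθ.1 (by linarith [hθ.2] : 0 ≤ 1 - θ) (by ring)
  have := hδW (convexComb_mem_Icc (hm₁ t) (hm₂ t) hθ) hball
  rw [h0, Real.dist_eq, sub_zero] at this
  exact (le_abs_self _).trans this.le

/-- The energy density of an interpolation between two profiles is bounded by an integrable
function up to an arbitrarily small constant. -/
theorem exists_interpolation_density_bound (hLam : 0 < Lam) (hW : IsDoubleWell W)
    (hq₁ : IsProfile Lam W q₁) (hq₂ : IsProfile Lam W q₂) (h : ℝ) (K : NNReal) {ε : ℝ}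
    (hε : 0 < ε) :
    ∃ ψ : ℝ → ℝ, Measurable ψ ∧ (∀ t, 0 ≤ ψ t) ∧ Integrable ψ ∧ ∀ t, ∀ θ ∈ Icc (0 : ℝ) 1,
      Lam / 2 * (|θ * deriv q₁ (t - h) + (1 - θ) * deriv q₂ t| + K * |q₁ (t - h) - q₂ t|) ^ 2 +
        W (θ * q₁ (t - h) + (1 - θ) * q₂ t) ≤ ε + ψ t := by
  obtain ⟨C, hC⟩ := isCompact_Icc.exists_bound_of_continuousOn hW.continuousOn
  have hC0 : 0 ≤ C := (norm_nonneg _).trans (hC 0 (by simp))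
  -- Chosen so that the cutoff term and the potential, each controlled by ε', add up to exactly ε.
  set ε' : ℝ := ε / (3 * Lam / 2 * K ^ 2 + 1) with hε'
  have hε'0 : 0 < ε' := by positivity
  have hε'ε : 3 * Lam / 2 * K ^ 2 * ε' + ε' = ε := by
    rw [hε']; field_simp
  obtain ⟨T₁, hT₁⟩ := eventually_atTop.1 (eventually_interpolation_le (f₁ := fun t => q₁ (t - h))
    (f₂ := q₂) (s₀ := 1) hW (by simp) ((hW.zero_iff 1 (by simp)).2 (Or.inr rfl))
    (hq₁.tendsto_atTop.comp (tendsto_atTop_add_const_right _ (-h) tendsto_id)) hq₂.tendsto_atTop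
    (fun t => hq₁.mem_Icc _) hq₂.mem_Icc hε'0)
  obtain ⟨T₂, hT₂⟩ := eventually_atBot.1 (eventually_interpolation_le (f₁ := fun t => q₁ (t - h))
    (f₂ := q₂) (s₀ := -1) hW (by simp) ((hW.zero_iff (-1) (by simp)).2 (Or.inl rfl))
    (hq₁.tendsto_atBot.comp (tendsto_atBot_add_const_right _ (-h) tendsto_id)) hq₂.tendsto_atBot
    (fun t => hq₁.mem_Icc _) hq₂.mem_Icc hε'0)
  set M : ℝ := 3 * Lam / 2 * K ^ 2 * 4 + C
  have hM : 0 ≤ M := by positivity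
  -- The derivatives are square integrable on the whole line. The other terms are below ε outside
  -- [T₂, T₁], and on that interval the constant M bounds them, since |q₁ - q₂| ≤ 2 and W ≤ C.
  refine ⟨fun t => 3 * Lam / 2 * (deriv q₁ (t - h) ^ 2 + deriv q₂ t ^ 2) +
    (Icc T₂ T₁).indicator (fun _ => M) t, ?_, fun t => ?_, ?_, fun t θ hθ => ?_⟩
  · refine Measurable.add (Measurable.const_mul (Measurable.add ?_ ?_) _)
      (measurable_const.indicator measurableSet_Icc)
    · exact ((measurable_deriv q₁).comp (measurable_id.sub_const h)).pow_const 2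
    · exact (measurable_deriv q₂).pow_const 2
  · exact add_nonneg (by positivity) (indicator_nonneg (fun _ _ => hM) t)
  · refine Integrable.add (Integrable.const_mul (Integrable.add ?_
      (hq₂.integrable_sq_deriv hLam hW)) _) ?_
    · exact (hq₁.integrable_sq_deriv hLam hW).comp_sub_right h
    · rw [integrable_indicator_iff measurableSet_Icc]
      exact integrableOn_const (by simp)
  · set a := deriv q₁ (t - h)
    set b := deriv q₂ t
    set D := |q₁ (t - h) - q₂ t| with hD
    have hab : |θ * a + (1 - θ) * b| ≤ |a| + |b| := by
      refine (abs_add_le _ _).trans (add_le_add ?_ ?_)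
      · rw [abs_mul, abs_of_nonneg hθ.1]; exact mul_le_of_le_one_left (abs_nonneg _) hθ.2
      · rw [abs_mul, abs_of_nonneg (by linarith [hθ.2] : 0 ≤ 1 - θ)]
        exact mul_le_of_le_one_left (abs_nonneg _) (by linarith [hθ.1])
    have hsq : (|θ * a + (1 - θ) * b| + K * D) ^ 2 ≤ 3 * (a ^ 2 + b ^ 2) + 3 * K ^ 2 * D ^ 2 := by
      calc (|θ * a + (1 - θ) * b| + K * D) ^ 2 ≤ (|a| + |b| + K * D) ^ 2 := by gcongr
        _ ≤ 3 * (|a| ^ 2 + |b| ^ 2) + 3 * (K * D) ^ 2 := by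
          nlinarith [sq_nonneg (|a| - |b|), sq_nonneg (|a| - K * D), sq_nonneg (|b| - K * D)]
        _ = _ := by rw [sq_abs, sq_abs]; ring
    have hlam : Lam / 2 * (|θ * a + (1 - θ) * b| + K * D) ^ 2 ≤
        3 * Lam / 2 * (a ^ 2 + b ^ 2) + 3 * Lam / 2 * K ^ 2 * D ^ 2 := by
      calc _ ≤ Lam / 2 * (3 * (a ^ 2 + b ^ 2) + 3 * K ^ 2 * D ^ 2) := by gcongr
        _ = _ := by ring
    have hc : (0 : ℝ) ≤ 3 * Lam / 2 * K ^ 2 := by positivity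
    suffices 3 * Lam / 2 * K ^ 2 * D ^ 2 + W (θ * q₁ (t - h) + (1 - θ) * q₂ t) ≤
        ε + (Icc T₂ T₁).indicator (fun _ => M) t by linarith
    by_cases ht : t ∈ Icc T₂ T₁
    · rw [indicator_of_mem ht]
      have hWC := (le_abs_self _).trans (hC _ (convexComb_mem_Icc (hq₁.mem_Icc (t - h))
        (hq₂.mem_Icc t) hθ))
      have hD2 : D ^ 2 ≤ 4 := by
        have h1 := hq₁.mem_Icc (t - h)
        have h2 := hq₂.mem_Icc t
        rw [hD, sq_abs]
        nlinarith [h1.1, h1.2, h2.1, h2.2]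
      have := mul_le_mul_of_nonneg_left hD2 hc
      have hMd : M = 3 * Lam / 2 * K ^ 2 * 4 + C := rfl
      linarith
    · rw [indicator_of_notMem ht, add_zero]
      have key : D ^ 2 ≤ ε' ∧ W (θ * q₁ (t - h) + (1 - θ) * q₂ t) ≤ ε' := by
        rw [hD, sq_abs]
        rcases le_or_gt T₁ t with h1 | h1
        · exact ⟨(hT₁ t h1).1, (hT₁ t h1).2 θ hθ⟩
        · have h2 : t ≤ T₂ := by
            by_contra! h2; exact ht ⟨h2.le, h1.le⟩
          exact ⟨(hT₂ t h2).1, (hT₂ t h2).2 θ hθ⟩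
      have := mul_le_mul_of_nonneg_left key.1 hc
      linarith [key.2]

end Profile

/-! ### Planar functions -/

section Planar

variable {n d : ℕ} (c : OrthonormalBasis (Fin (n + 1)) ℝ (E d))

/-- Enclose the translate of `A` in a cube of half side ρ. The constant is the square root of the
volume of the cube's cross section. This carries one-dimensional approximations over to planar
functions. -/
theorem exists_eLpNorm_comp_inner_le {A : Set (E d)} (hA : Bornology.IsBounded A) (x₀ : E d) :
    ∃ ρ : ℝ, ∃ K : NNReal, ∀ F : ℝ → ℝ, Measurable F →
      eLpNorm (fun y => F (inner ℝ (y - x₀) (c 0))) 2 (volume.restrict A) ≤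
        K * eLpNorm F 2 (volume.restrict (Ioo (-ρ) ρ)) := by
  set B : Set (E d) := (fun y => y + x₀) ⁻¹' A with hB
  have hBA : A = (fun y => y - x₀) ⁻¹' B := by ext y; simp [hB]
  obtain ⟨ρ, hρ⟩ := hA.subset_ball x₀
  have hBρ : ∀ y ∈ B, ∀ i, |inner ℝ y (c i)| < ρ := fun y hy i => by
    have h1 : ‖y‖ < ρ := by simpa [hB, dist_eq_norm] using hρ hy
    refine lt_of_le_of_lt ?_ h1
    simpa using abs_real_inner_le_norm y (c i)
  set T : Set (Fin n → ℝ) := univ.pi fun _ => Ioo (-ρ) ρ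
  have hT : volume T ≠ ⊤ := by
    simp only [T, Real.volume_pi_Ioo]
    exact ENNReal.prod_ne_top fun _ _ => ENNReal.ofReal_ne_top
  have hmap := map_inner_restrict_le c (A := B) (S := Ioo (-ρ) ρ) (T := T) measurableSet_Ioo
    (MeasurableSet.univ_pi fun _ => measurableSet_Ioo) fun y hy =>
      ⟨abs_lt.1 (hBρ y hy 0), fun i _ => abs_lt.1 (hBρ y hy i.succ)⟩
  refine ⟨ρ, (volume T ^ ((1 / 2 : ℝ≥0∞)).toReal).toNNReal, fun F hF => ?_⟩
  have hmp := measurePreserving_sub_restrict B x₀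
  rw [← hBA] at hmp
  have hm : Measurable fun y : E d => inner ℝ y (c 0) := by fun_prop
  calc eLpNorm (fun y => F (inner ℝ (y - x₀) (c 0))) 2 (volume.restrict A)
      = eLpNorm (fun y => F (inner ℝ y (c 0))) 2 (volume.restrict B) :=
        eLpNorm_comp_measurePreserving (hF.comp hm).aestronglyMeasurable hmp
    _ = eLpNorm F 2 (Measure.map (fun y : E d => inner ℝ y (c 0)) (volume.restrict B)) :=
        (eLpNorm_map_measure hF.aestronglyMeasurable hm.aemeasurable).symm
    _ ≤ eLpNorm F 2 (volume T • volume.restrict (Ioo (-ρ) ρ)) := eLpNorm_mono_measure _ hmap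
    _ = _ := by
      rw [eLpNorm_smul_measure_of_ne_top (by norm_num), smul_eq_mul, ENNReal.coe_toNNReal]
      exact ENNReal.rpow_ne_top_of_nonneg ENNReal.toReal_nonneg hT

theorem gradient_comp_inner {Q : ℝ → ℝ} (hQ : Differentiable ℝ Q) (e x₀ y : E d) :
    gradient (fun y => Q (inner ℝ (y - x₀) e)) y = deriv Q (inner ℝ (y - x₀) e) • e := by
  have h1 : HasFDerivAt (fun y : E d => inner ℝ (y - x₀) e) (innerSL ℝ e) y := by
    have := ((innerSL ℝ e).hasFDerivAt (x := y - x₀)).comp y ((hasFDerivAt_id y).sub_const x₀)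
    simpa [Function.comp_def, real_inner_comm] using this
  have h2 := (hQ (inner ℝ (y - x₀) e)).hasDerivAt.comp_hasFDerivAt y h1
  refine HasGradientAt.gradient (hasGradientAt_iff_hasFDerivAt.2 ?_)
  have h3 : InnerProductSpace.toDual ℝ (E d) (deriv Q (inner ℝ (y - x₀) e) • e) =
      deriv Q (inner ℝ (y - x₀) e) • innerSL ℝ e := by
    ext v
    simp
  rw [h3]
  exact h2

theorem eLpNorm_smul_unit {μ : Measure (E d)} {F : E d → ℝ} {e : E d} (he : ‖e‖ = 1) :
    eLpNorm (fun y => F y • e) 2 μ = eLpNorm F 2 μ :=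
  eLpNorm_congr_norm_ae (.of_forall fun y => by rw [norm_smul, he, mul_one])

theorem hasH1Gradient_planar {Lam : ℝ} {W q : ℝ → ℝ} (hLam : 0 < Lam) (hW : IsDoubleWell W)
    (hq : IsProfile Lam W q) {A : Set (E d)} (hA : Bornology.IsBounded A) (x₀ : E d) :
    HasH1Gradient A (planar q (c 0) x₀) fun y => deriv q (inner ℝ (y - x₀) (c 0)) • c 0 := by
  obtain ⟨ρ, K, hK⟩ := exists_eLpNorm_comp_inner_le c hA x₀
  have hm : Measurable fun y : E d => inner ℝ (y - x₀) (c 0) := by fun_prop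
  have hqm := hq.continuous.measurable
  refine ⟨⟨(hqm.comp hm).aestronglyMeasurable, (hK q hqm).trans_lt ?_⟩,
    ⟨(((measurable_deriv q).comp hm).smul_const (c 0)).aestronglyMeasurable, ?_⟩, fun ε hε => ?_⟩
  · refine ENNReal.mul_lt_top (by simp) ?_
    refine (MemLp.of_bound hqm.aestronglyMeasurable 1 (.of_forall fun t => ?_)).2
    exact abs_le.2 (hq.mem_Icc t)
  · rw [eLpNorm_smul_unit (F := fun y => deriv q (inner ℝ (y - x₀) (c 0))) (c.norm_eq_one 0)]
    exact (hK _ (measurable_deriv q)).trans_lt (ENNReal.mul_lt_top (by simp)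
      ((hq.memLp_deriv hLam hW).mono_measure Measure.restrict_le_self).2)
  · obtain ⟨δ, hδ, -, hδK⟩ := exists_pos_add_mul_lt hε K
    obtain ⟨Q, hQ, hQ1, hQ2⟩ := hq.exists_smooth_approx hLam hW ρ hδ
    refine ⟨fun y => Q (inner ℝ (y - x₀) (c 0)), ?_, ?_, ?_⟩
    · exact (hQ.comp ((contDiff_id.sub contDiff_const).inner ℝ contDiff_const)).contDiffOn
    · refine (hK (q - Q) (hqm.sub hQ.continuous.measurable)).trans_lt ?_
      simpa using hδK 0 _ hδ hQ1
    · have : ((fun y => deriv q (inner ℝ (y - x₀) (c 0)) • c 0) -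
          gradient fun y => Q (inner ℝ (y - x₀) (c 0))) =
          fun y => (deriv q - deriv Q) (inner ℝ (y - x₀) (c 0)) • c 0 := by
        ext1 y
        simp only [Pi.sub_apply, gradient_comp_inner (hQ.differentiable (by simp)), sub_smul]
      rw [this, eLpNorm_smul_unit (F := fun y => (deriv q - deriv Q) (inner ℝ (y - x₀) (c 0)))
        (c.norm_eq_one 0)]
      refine (hK _ ((measurable_deriv q).sub (measurable_deriv Q))).trans_lt ?_
      simpa using hδK 0 _ hδ hQ2

end Planar


/-! ### Properties of Finsler norms -/

section Finsler

variable {d : ℕ} {lam Lam : ℝ}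

theorem homogExt_zero (f : Sph d → ℝ) : homogExt f 0 = 0 := dif_pos rfl

theorem homogExt_nonneg (f : FinslerNorms d lam Lam) (p : E d) : 0 ≤ homogExt f.1 p := by
  unfold homogExt
  split_ifs with h
  · exact le_rfl
  · exact mul_nonneg (norm_nonneg _) ((Real.sqrt_nonneg _).trans (f.2.1 _).1)

theorem homogExt_le (f : FinslerNorms d lam Lam) (p : E d) : homogExt f.1 p ≤ √Lam * ‖p‖ := by
  unfold homogExt
  split_ifs with h
  · positivity
  · rw [mul_comm]
    exact mul_le_mul_of_nonneg_right (f.2.1 _).2 (norm_nonneg _)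

theorem homogExt_two_smul (f : Sph d → ℝ) (p : E d) :
    homogExt f ((2 : ℝ) • p) = 2 * homogExt f p := by
  by_cases h : p = 0
  · simp [h, homogExt_zero]
  · have h2 : (2 : ℝ) • p ≠ 0 := smul_ne_zero two_ne_zero h
    simp only [homogExt, dif_neg h, dif_neg h2]
    have : ‖(2 : ℝ) • p‖⁻¹ • (2 : ℝ) • p = ‖p‖⁻¹ • p := by
      rw [norm_smul, smul_smul]
      congr 1
      have := norm_ne_zero_iff.2 h
      rw [Real.norm_of_nonneg zero_le_two]
      field_simp
    have hn : ‖(2 : ℝ) • p‖ = 2 * ‖p‖ := by rw [norm_smul, Real.norm_of_nonneg zero_le_two]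
    simp only [this]
    refine (congrArg (· * _) hn).trans (mul_assoc _ _ _)

/-- Convexity at the midpoint of 2p and 2q; only homogeneity for the factor 2 is used. -/
theorem homogExt_add_le (f : FinslerNorms d lam Lam) (p q : E d) :
    homogExt f.1 (p + q) ≤ homogExt f.1 p + homogExt f.1 q := by
  have := f.2.2.2 (mem_univ ((2 : ℝ) • p)) (mem_univ ((2 : ℝ) • q))
    (by norm_num : (0 : ℝ) ≤ 1 / 2) (by norm_num : (0 : ℝ) ≤ 1 / 2) (by norm_num)
  rw [smul_smul, smul_smul, homogExt_two_smul, homogExt_two_smul] at this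
  norm_num at this
  simpa using this

theorem continuous_homogExt (f : FinslerNorms d lam Lam) : Continuous (homogExt f.1) := by
  have h : ∀ p q, homogExt f.1 p - homogExt f.1 q ≤ √Lam * ‖p - q‖ := fun p q => by
    have h1 := homogExt_add_le f q (p - q)
    have h2 := homogExt_le f (p - q)
    rw [add_sub_cancel] at h1
    linarith
  refine (LipschitzWith.of_dist_le_mul (K := ⟨√Lam, Real.sqrt_nonneg _⟩) fun p q => ?_).continuous
  rw [Real.dist_eq, dist_eq_norm]
  exact abs_sub_le_iff.2 ⟨h p q, norm_sub_rev p q ▸ h q p⟩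

theorem continuous_homogExt_left (p : E d) :
    Continuous fun f : FinslerNorms d lam Lam => homogExt f.1 p := by
  unfold homogExt
  split_ifs with h
  · exact continuous_const
  · exact continuous_const.mul ((continuous_eval_const _).comp continuous_subtype_val)

theorem half_sq_homogExt_le (hLam : 0 < Lam) (f : FinslerNorms d lam Lam) (p : E d) :
    1 / 2 * homogExt f.1 p ^ 2 ≤ Lam / 2 * ‖p‖ ^ 2 := by
  have h := pow_le_pow_left₀ (homogExt_nonneg f p) (homogExt_le f p) 2
  rw [mul_pow, Real.sq_sqrt hLam.le] at h
  linarith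

theorem half_sq_homogExt_le_add (hLam : 0 < Lam) (f : FinslerNorms d lam Lam) (p q : E d) :
    1 / 2 * homogExt f.1 q ^ 2 ≤ 1 / 2 * homogExt f.1 p ^ 2 +
      (Lam * (‖p‖ * ‖q - p‖) + Lam * (‖q - p‖ * ‖q - p‖)) := by
  have h1 := homogExt_add_le f p (q - p)
  rw [add_sub_cancel] at h1
  have h2 := homogExt_le f (q - p)
  have h3 := homogExt_le f p
  have h0 := homogExt_nonneg f p
  have h0' := homogExt_nonneg f q
  have h4 : homogExt f.1 q ≤ homogExt f.1 p + √Lam * ‖q - p‖ := by linarith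
  have h5 := pow_le_pow_left₀ h0' h4 2
  have h6 : homogExt f.1 p * (√Lam * ‖q - p‖) ≤ Lam * (‖p‖ * ‖q - p‖) := by
    calc _ ≤ (√Lam * ‖p‖) * (√Lam * ‖q - p‖) := by gcongr
      _ = (√Lam * √Lam) * (‖p‖ * ‖q - p‖) := by ring
      _ = _ := by rw [Real.mul_self_sqrt hLam.le]
  have h7 : (√Lam * ‖q - p‖) ^ 2 = Lam * (‖q - p‖ * ‖q - p‖) := by
    rw [mul_pow, Real.sq_sqrt hLam.le]; ring
  have h8 : 0 ≤ Lam * (‖q - p‖ * ‖q - p‖) := by positivity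
  nlinarith

end Finsler

/-! ### Clamping the potential -/

section Energy

variable {d : ℕ} {lam Lam : ℝ} {Ω : Type*} {W : ℝ → ℝ} {τ : E d → Ω → Ω}
  {Φ : Ω → FinslerNorms d lam Lam} {A : Set (E d)} {u u' : E d → ℝ} {g g' : E d → E d} {ω : Ω}

/-- The potential, extended from `[-1, 1]` to `ℝ` by constants. -/
def clamp (W : ℝ → ℝ) (s : ℝ) : ℝ := W (max (-1) (min 1 s))

theorem clamp_mem (s : ℝ) : max (-1) (min 1 s) ∈ Icc (-1 : ℝ) 1 := by simp

theorem clamp_eq {s : ℝ} (hs : s ∈ Icc (-1 : ℝ) 1) : clamp W s = W s := by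
  rw [clamp, min_eq_right hs.2, max_eq_right hs.1]

theorem continuous_clamp (hW : IsDoubleWell W) : Continuous (clamp W) :=
  hW.continuousOn.comp_continuous (by fun_prop) clamp_mem

theorem clamp_nonneg (hW : IsDoubleWell W) (s : ℝ) : 0 ≤ clamp W s := hW.nonneg _ (clamp_mem s)

theorem exists_clamp_le (hW : IsDoubleWell W) : ∃ C, 0 ≤ C ∧ ∀ s, clamp W s ≤ C := by
  obtain ⟨C, hC⟩ := isCompact_Icc.exists_bound_of_continuousOn hW.continuousOn
  exact ⟨C, (norm_nonneg _).trans (hC 0 (by simp)),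
    fun s => (le_abs_self _).trans (hC _ (clamp_mem s))⟩

theorem energy_congr_clamp (hu : ∀ᵐ x ∂(volume.restrict A), u x ∈ Icc (-1 : ℝ) 1)
    (huu' : u =ᵐ[volume.restrict A] u') (hgg' : g =ᵐ[volume.restrict A] g') :
    energy W τ Φ ω A u g =
      ∫⁻ x in A, ENNReal.ofReal (1 / 2 * finslerMetric τ Φ ω x (g' x) ^ 2 + clamp W (u' x)) := by
  refine lintegral_congr_ae ?_
  filter_upwards [hu, huu', hgg'] with x h1 h2 h3
  rw [← h2, ← h3, clamp_eq h1]

/-! ### Continuity of the energy -/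

theorem energy_le_add_error (hLam : 0 < Lam) (hW : IsDoubleWell W) (ω : Ω)
    (hum : AEStronglyMeasurable u (volume.restrict A))
    (hum' : AEStronglyMeasurable u' (volume.restrict A))
    (hgm : AEStronglyMeasurable g (volume.restrict A))
    (hgm' : AEStronglyMeasurable g' (volume.restrict A))
    (hu : ∀ᵐ x ∂(volume.restrict A), u x ∈ Icc (-1 : ℝ) 1)
    (hu' : ∀ᵐ x ∂(volume.restrict A), u' x ∈ Icc (-1 : ℝ) 1) :
    energy W τ Φ ω A u' g' ≤ energy W τ Φ ω A u g +
      (ENNReal.ofReal Lam * (eLpNorm g 2 (volume.restrict A) *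
          eLpNorm (g' - g) 2 (volume.restrict A)) +
        ENNReal.ofReal Lam * (eLpNorm (g' - g) 2 (volume.restrict A) *
          eLpNorm (g' - g) 2 (volume.restrict A)) +
        ∫⁻ x in A, ENNReal.ofReal |clamp W (u' x) - clamp W (u x)|) := by
  set μ := volume.restrict A
  have hprod : ∀ {k k' : E d → E d}, AEStronglyMeasurable k μ → AEStronglyMeasurable k' μ →
      ∫⁻ x, ENNReal.ofReal (Lam * (‖k x‖ * ‖k' x‖)) ∂μ ≤
        ENNReal.ofReal Lam * (eLpNorm k 2 μ * eLpNorm k' 2 μ) := by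
    intro k k' hk hk'
    have h1 : ∀ x, ENNReal.ofReal (Lam * (‖k x‖ * ‖k' x‖)) =
        ENNReal.ofReal Lam * ‖((fun x => ‖k x‖) • k') x‖ₑ := fun x => by
      rw [ENNReal.ofReal_mul hLam.le, Pi.smul_apply', ← ofReal_norm, norm_smul, norm_norm]
    simp_rw [h1]
    rw [lintegral_const_mul' _ _ ENNReal.ofReal_ne_top, ← eLpNorm_one_eq_lintegral_enorm]
    gcongr
    refine (eLpNorm_smul_le_mul_eLpNorm (p := 2) (q := 2) hk' hk.norm).trans ?_
    rw [eLpNorm_norm]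
  have hclamp : ∀ {w : E d → ℝ}, AEStronglyMeasurable w μ →
      AEMeasurable (fun x => clamp W (w x)) μ := fun hw =>
    (continuous_clamp hW).measurable.comp_aemeasurable hw.aemeasurable
  have hE : energy W τ Φ ω A u' g' ≤ ∫⁻ x, (ENNReal.ofReal
      (1 / 2 * finslerMetric τ Φ ω x (g x) ^ 2 + W (u x)) +
      ((ENNReal.ofReal (Lam * (‖g x‖ * ‖(g' - g) x‖)) +
        ENNReal.ofReal (Lam * (‖(g' - g) x‖ * ‖(g' - g) x‖))) +
        ENNReal.ofReal |clamp W (u' x) - clamp W (u x)|)) ∂μ := by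
    refine lintegral_mono_ae ?_
    filter_upwards [hu, hu'] with x h1 h2
    have h3 := half_sq_homogExt_le_add hLam (Φ (τ x ω)) (g x) (g' x)
    have h4 := le_abs_self (clamp W (u' x) - clamp W (u x))
    have h5 := clamp_nonneg hW (u x)
    rw [← clamp_eq (W := W) h1, ← clamp_eq (W := W) h2, ← ENNReal.ofReal_add (by positivity)
      (by positivity), ← ENNReal.ofReal_add (by positivity) (by positivity),
      ← ENNReal.ofReal_add (by positivity) (by positivity)]
    refine ENNReal.ofReal_le_ofReal ?_
    simp only [finslerMetric, Pi.sub_apply]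
    linarith
  refine hE.trans ?_
  -- Only the error terms need to be measurable, so no measurability in x of the metric for fixed ω
  -- is required.
  rw [lintegral_add_right', lintegral_add_right', lintegral_add_right']
  · refine add_le_add le_rfl (add_le_add (add_le_add ?_ ?_) le_rfl)
    · exact hprod hgm (hgm'.sub hgm)
    · exact hprod (hgm'.sub hgm) (hgm'.sub hgm)
  · exact (((hgm'.sub hgm).norm.mul (hgm'.sub hgm).norm).aemeasurable.const_mul _).ennreal_ofReal
  · exact ((hclamp hum').sub (hclamp hum)).norm.ennreal_ofReal
  · exact (((hgm.norm.mul (hgm'.sub hgm).norm).aemeasurable.const_mul _).ennreal_ofReal.add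
      (((hgm'.sub hgm).norm.mul (hgm'.sub hgm).norm).aemeasurable.const_mul _).ennreal_ofReal).add
      ((hclamp hum').sub (hclamp hum)).norm.ennreal_ofReal

/-- The energy is upper semicontinuous along sequences converging in `L²`. -/
theorem exists_energy_lt_of_tendsto (hLam : 0 < Lam) (hW : IsDoubleWell W) (ω : Ω)
    (hA : volume A ≠ ⊤) {us : ℕ → E d → ℝ} {gs : ℕ → E d → E d}
    (hu : MemLp u 2 (volume.restrict A)) (hg : MemLp g 2 (volume.restrict A))
    (hus : ∀ k, MemLp (us k) 2 (volume.restrict A)) (hgs : ∀ k, MemLp (gs k) 2 (volume.restrict A))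
    (hu1 : ∀ᵐ x ∂(volume.restrict A), u x ∈ Icc (-1 : ℝ) 1)
    (hus1 : ∀ k, ∀ᵐ x ∂(volume.restrict A), us k x ∈ Icc (-1 : ℝ) 1)
    (htu : Tendsto (fun k => eLpNorm (us k - u) 2 (volume.restrict A)) atTop (𝓝 0))
    (htg : Tendsto (fun k => eLpNorm (gs k - g) 2 (volume.restrict A)) atTop (𝓝 0))
    {r : ℝ≥0∞} (hr : energy W τ Φ ω A u g < r) : ∃ k, energy W τ Φ ω A (us k) (gs k) < r := by
  -- Along an a.e. convergent subsequence the potential term is handled by dominated convergence: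
  -- the clamped potential is bounded and `A` has finite volume.
  obtain ⟨m, hm, hae⟩ := (tendstoInMeasure_of_tendsto_eLpNorm two_ne_zero
    (fun k => (hus k).1) hu.1 htu).exists_seq_tendsto_ae
  obtain ⟨C, hC0, hC⟩ := exists_clamp_le hW
  have : IsFiniteMeasure (volume.restrict A) := isFiniteMeasure_restrict.2 hA
  have hclamp : ∀ {w : E d → ℝ}, AEStronglyMeasurable w (volume.restrict A) →
      AEMeasurable (fun x => clamp W (w x)) (volume.restrict A) := fun hw =>
    (continuous_clamp hW).measurable.comp_aemeasurable hw.aemeasurable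
  have hpot : Tendsto (fun k => ∫⁻ x in A, ENNReal.ofReal |clamp W (us (m k) x) - clamp W (u x)|)
      atTop (𝓝 0) := by
    have h0 : (0 : ℝ≥0∞) = ∫⁻ _ in A, 0 := by simp
    rw [h0]
    refine tendsto_lintegral_of_dominated_convergence' (fun _ => ENNReal.ofReal C)
      (fun k => ((hclamp (hus (m k)).1).sub (hclamp hu.1)).norm.ennreal_ofReal)
      (fun k => .of_forall fun x => ENNReal.ofReal_le_ofReal ?_) ?_ ?_
    · exact abs_sub_le_iff.2 ⟨by linarith [hC (us (m k) x), clamp_nonneg hW (u x)],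
        by linarith [hC (u x), clamp_nonneg hW (us (m k) x)]⟩
    · rw [lintegral_const]
      exact ENNReal.mul_ne_top ENNReal.ofReal_ne_top (measure_ne_top _ _)
    · filter_upwards [hae] with x hx
      have h1 := ((continuous_clamp hW).tendsto (u x)).comp hx
      have h2 := ENNReal.tendsto_ofReal ((h1.sub_const (clamp W (u x))).abs)
      simpa using h2
  have htg' := htg.comp hm.tendsto_atTop
  have herr : Tendsto (fun k => energy W τ Φ ω A u g +
      (ENNReal.ofReal Lam * (eLpNorm g 2 (volume.restrict A) *
          eLpNorm (gs (m k) - g) 2 (volume.restrict A)) +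
        ENNReal.ofReal Lam * (eLpNorm (gs (m k) - g) 2 (volume.restrict A) *
          eLpNorm (gs (m k) - g) 2 (volume.restrict A)) +
        ∫⁻ x in A, ENNReal.ofReal |clamp W (us (m k) x) - clamp W (u x)|)) atTop
      (𝓝 (energy W τ Φ ω A u g + (ENNReal.ofReal Lam * (eLpNorm g 2 (volume.restrict A) * 0) +
        ENNReal.ofReal Lam * (0 * 0) + 0))) := by
    refine tendsto_const_nhds.add (((ENNReal.Tendsto.const_mul (ENNReal.Tendsto.const_mul htg'
      (Or.inr hg.2.ne)) (Or.inr ENNReal.ofReal_ne_top)).add (ENNReal.Tendsto.const_mul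
      (ENNReal.Tendsto.mul htg' (by simp) htg' (by simp)) (Or.inr ENNReal.ofReal_ne_top))).add hpot)
  simp only [mul_zero, add_zero] at herr
  obtain ⟨k, hk⟩ := (herr.eventually_lt_const hr).exists
  exact ⟨m k, (energy_le_add_error hLam hW ω hu.1 (hus _).1 hg.1 (hgs _).1 hu1 (hus1 _)).trans_lt hk⟩

/-! ### Measurability of the energy -/

/-- The identity map from `ℝᵈ` with the Lebesgue `σ`-algebra to `ℝᵈ` with the Borel one. -/
def ofNull (x : NullMeasurableSpace (E d) volume) : E d := x

theorem measurable_ofNull : Measurable (ofNull (d := d)) := fun _ hs => hs.nullMeasurableSet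

theorem map_ofNull_completion :
    Measure.map ofNull (volume : Measure (E d)).completion = volume := by
  ext s hs
  rw [Measure.map_apply measurable_ofNull hs]
  exact Measure.completion_apply volume s

/-- The action is only Lebesgue measurable in x, so Tonelli's theorem has to be applied to the
completed measure. The integral does not change, because the integrand agrees a.e. with a Borel
function. -/
theorem lintegral_completion_restrict (hA : MeasurableSet A) {f : E d → ℝ≥0∞}
    (hf : Measurable fun x => f (ofNull x)) :
    ∫⁻ x, f (ofNull x) ∂((volume : Measure (E d)).completion.restrict (ofNull ⁻¹' A)) =
      ∫⁻ x in A, f x := by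
  have hnull : NullMeasurable f volume := fun s hs => hf hs
  obtain ⟨f', hf', hff'⟩ := hnull.aemeasurable
  have hmap : Measure.map ofNull
      ((volume : Measure (E d)).completion.restrict (ofNull ⁻¹' A)) = volume.restrict A := by
    rw [← Measure.restrict_map measurable_ofNull hA, map_ofNull_completion]
  rw [lintegral_congr_ae (ae_restrict_of_ae hff'), ← hmap, lintegral_map hf' measurable_ofNull]
  refine lintegral_congr_ae (ae_restrict_of_ae ?_)
  rw [Measure.ae_completion]
  exact hff'

variable [MeasurableSpace Ω] {P : Measure Ω}

/-- A Carathéodory function: continuous in the gradient variable, and measurable in (x, ω) for each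
fixed value of it. -/
theorem measurable_finslerMetric (hτ : IsErgodicAction P τ)
    (hΦ : Measurable[_, borel (FinslerNorms d lam Lam)] Φ) {g : E d → E d} (hg : Measurable g) :
    Measurable fun z : NullMeasurableSpace (E d) volume × Ω =>
      finslerMetric τ Φ z.2 (ofNull z.1) (g (ofNull z.1)) := by
  let _ : MeasurableSpace (FinslerNorms d lam Lam) := borel _
  have : BorelSpace (FinslerNorms d lam Lam) := ⟨rfl⟩
  have h1 : Measurable (Function.uncurry fun (p : E d)
      (z : NullMeasurableSpace (E d) volume × Ω) =>
        homogExt (Φ (τ (ofNull z.1) z.2)).1 p) :=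
    measurable_uncurry_of_continuous_of_measurable (fun z => continuous_homogExt _)
      fun p => (continuous_homogExt_left p).measurable.comp (hΦ.comp hτ.measurable)
  exact h1.comp (((hg.comp measurable_ofNull).comp measurable_fst).prodMk measurable_id)

theorem measurable_energy (hW : IsDoubleWell W) (hτ : IsErgodicAction P τ)
    (hΦ : Measurable[_, borel (FinslerNorms d lam Lam)] Φ) (hA : MeasurableSet A)
    (hA' : volume A ≠ ⊤) (hu : AEStronglyMeasurable u (volume.restrict A))
    (hg : AEStronglyMeasurable g (volume.restrict A))
    (hu1 : ∀ᵐ x ∂(volume.restrict A), u x ∈ Icc (-1 : ℝ) 1) :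
    Measurable fun ω => energy W τ Φ ω A u g := by
  obtain ⟨u', hu', huu'⟩ := hu.aemeasurable
  obtain ⟨g', hg', hgg'⟩ := hg.aemeasurable
  simp_rw [energy_congr_clamp hu1 huu' hgg']
  have hm : Measurable fun z : NullMeasurableSpace (E d) volume × Ω => ENNReal.ofReal
      (1 / 2 * finslerMetric τ Φ z.2 (ofNull z.1) (g' (ofNull z.1)) ^ 2 + clamp W (u' (ofNull z.1))) :=
    ((((measurable_finslerMetric hτ hΦ hg').pow_const 2).const_mul _).add
      ((continuous_clamp hW).measurable.comp ((hu'.comp measurable_ofNull).comp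
        measurable_fst))).ennreal_ofReal
  have : IsFiniteMeasure ((volume : Measure (E d)).completion.restrict (ofNull ⁻¹' A)) :=
    ⟨by rw [Measure.restrict_apply_univ]; exact hA'.lt_top⟩
  have h2 := hm.lintegral_prod_left' (μ := (volume : Measure (E d)).completion.restrict (ofNull ⁻¹' A))
  refine (congrArg Measurable (funext fun ω => ?_)).mp h2
  exact lintegral_completion_restrict hA (hm.comp measurable_prodMk_right)

/-- The finite-volume surface tension is a measurable function of the medium. -/
theorem measurable_finiteVolume (hLam : 0 < Lam) (hW : IsDoubleWell W) (hτ : IsErgodicAction P τ)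
    (hΦ : Measurable[_, borel (FinslerNorms d lam Lam)] Φ) (hA : MeasurableSet A)
    (hA' : volume A ≠ ⊤) (q : ℝ → ℝ) (e x₀ : E d) :
    Measurable fun ω => finiteVolume W τ Φ q ω e x₀ A := by
  let S : Type := {p : (E d → ℝ) × (E d → E d) // HasH1Gradient A p.1 p.2 ∧
    (∀ᵐ x ∂(volume.restrict A), p.1 x ∈ Icc (-1 : ℝ) 1) ∧ MemH10 A (p.1 - planar q e x₀)}
  let ι : S → Lp ℝ 2 (volume.restrict A) × Lp (E d) 2 (volume.restrict A) := fun s =>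
    (MemLp.toLp s.1.1 s.2.1.1, MemLp.toLp s.1.2 s.2.1.2.1)
  -- Admissible pairs inherit second countability from L² × L², hence have a countable dense subset.
  -- By upper semicontinuity of the energy the infimum over that subset is the full infimum, with
  -- the same subset for every ω.
  let _ : TopologicalSpace S := TopologicalSpace.induced ι inferInstance
  have hι : Topology.IsInducing ι := ⟨rfl⟩
  have : Fact ((2 : ℝ≥0∞) ≠ ⊤) := ⟨by norm_num⟩
  have : SecondCountableTopology (Lp ℝ 2 (volume.restrict A)) := Lp.SecondCountableTopology
  have : SecondCountableTopology (Lp (E d) 2 (volume.restrict A)) := Lp.SecondCountableTopology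
  have : SecondCountableTopology S := hι.secondCountableTopology
  obtain ⟨D, hD, hDd⟩ := TopologicalSpace.exists_countable_dense S
  have hEq : ∀ ω, finiteVolume W τ Φ q ω e x₀ A =
      ⨅ s ∈ D, energy W τ Φ ω A s.1.1 s.1.2 := by
    intro ω
    refine le_antisymm (le_iInf₂ fun s _ => sInf_le ⟨_, _, s.2.1, s.2.2.1, s.2.2.2, rfl⟩) ?_
    refine le_sInf ?_
    rintro _ ⟨u, g, h1, h2, h3, rfl⟩
    refine le_of_forall_gt fun r hr => ?_
    let s : S := ⟨(u, g), h1, h2, h3⟩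
    obtain ⟨x, hxD, hx⟩ := mem_closure_iff_seq_limit.1 (hDd s)
    have hx' := (hι.continuous.tendsto s).comp hx
    have hxu := (Lp.tendsto_Lp_iff_tendsto_eLpNorm'' (fun k => (x k).1.1)
      (fun k => (x k).2.1.1) u h1.1).1 ((continuous_fst.tendsto _).comp hx')
    have hxg := (Lp.tendsto_Lp_iff_tendsto_eLpNorm'' (fun k => (x k).1.2)
      (fun k => (x k).2.1.2.1) g h1.2.1).1 ((continuous_snd.tendsto _).comp hx')
    obtain ⟨k, hk⟩ := exists_energy_lt_of_tendsto hLam hW ω hA' h1.1 h1.2.1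
      (fun k => (x k).2.1.1) (fun k => (x k).2.1.2.1) h2 (fun k => (x k).2.2.1) hxu hxg hr
    exact (iInf₂_le (x k) (hxD k)).trans_lt hk
  simp_rw [hEq]
  exact Measurable.biInf D hD fun s _ => measurable_energy hW hτ hΦ hA hA' s.2.1.1.1
    s.2.1.2.1.1 s.2.2.1

end Energy


/-! ### Gluing competitors -/

section Glue

variable {n d : ℕ} {lam Lam : ℝ} {Ω : Type*} {W q₁ q₂ : ℝ → ℝ} {τ : E d → Ω → Ω}
  {Φ : Ω → FinslerNorms d lam Lam}

/-- A competitor `u` on `A` for the shifted medium, translated by `x`, can be extended to a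
competitor on `B ⊇ A + x` with boundary values given by another profile. -/
theorem finiteVolume_le_energy_add (hLam : 0 < Lam) (hW : IsDoubleWell W)
    (hτ : ∀ x y, τ (x + y) = τ x ∘ τ y) (c : OrthonormalBasis (Fin (n + 1)) ℝ (E d))
    (hq₁ : IsProfile Lam W q₁) (hq₂ : IsProfile Lam W q₂) {A B : Set (E d)} (hA : IsOpen A)
    (hAb : Bornology.IsBounded A) (hB : IsOpen B) (hBb : Bornology.IsBounded B) (x : E d)
    (hAB : (fun y => y - x) ⁻¹' A ⊆ B) {χ : E d → ℝ} {K : NNReal}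
    (hχ : ContDiff ℝ ((⊤ : ℕ∞) : WithTop ℕ∞) χ) (hχ01 : ∀ y, χ y ∈ Icc (0 : ℝ) 1)
    (hχK : ∀ y, ‖gradient χ y‖ ≤ K) (hχ1 : ∀ y, y - x ∈ A → χ y = 1)
    (hχc : HasCompactSupport χ) (hχB : tsupport χ ⊆ B) {ω : Ω} {u : E d → ℝ} {g : E d → E d}
    (hug : HasH1Gradient A u g) (hu1 : ∀ᵐ y ∂(volume.restrict A), u y ∈ Icc (-1 : ℝ) 1)
    (hu0 : MemH10 A (u - planar q₁ (c 0) 0)) :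
    finiteVolume W τ Φ q₂ ω (c 0) 0 B ≤ energy W τ Φ (τ x ω) A u g +
      ∫⁻ y in B \ (fun y => y - x) ⁻¹' A, ENNReal.ofReal (Lam / 2 *
        (|χ y * deriv q₁ (inner ℝ y (c 0) - inner ℝ x (c 0)) +
            (1 - χ y) * deriv q₂ (inner ℝ y (c 0))| +
          K * |q₁ (inner ℝ y (c 0) - inner ℝ x (c 0)) - q₂ (inner ℝ y (c 0))|) ^ 2 +
        W (χ y * q₁ (inner ℝ y (c 0) - inner ℝ x (c 0)) + (1 - χ y) * q₂ (inner ℝ y (c 0)))) := by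
  set A' : Set (E d) := (fun y => y - x) ⁻¹' A with hA'
  have hA'o : IsOpen A' := hA.preimage (by fun_prop)
  have hmp := measurePreserving_sub_restrict A x
  obtain ⟨g₁, hg₁⟩ := memH10_iff_exists.1 hu0
  -- By uniqueness of the weak gradient, the given `g` is the one inherited from the boundary
  -- condition, so the glued function has the same energy density on the translate of `A`.
  have hgeq : g =ᵐ[volume.restrict A] g₁ + fun y => deriv q₁ (inner ℝ (y - 0) (c 0)) • c 0 := by
    refine hug.ae_eq hA ?_
    have := hg₁.hasH1Gradient.add hA (hasH1Gradient_planar c hLam hW hq₁ hAb 0)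
    rwa [sub_add_cancel] at this
  have hV₁ := (hg₁.translate x).extend_zero hA'o hAB
  set D₁ : E d → E d := fun y => deriv q₁ (inner ℝ (y - x) (c 0)) • c 0 with hD₁
  set D₂ : E d → E d := fun y => deriv q₂ (inner ℝ (y - 0) (c 0)) • c 0 with hD₂
  have hP₁ : HasH1Gradient B (planar q₁ (c 0) x) D₁ := hasH1Gradient_planar c hLam hW hq₁ hBb x
  have hP₂ : HasH1Gradient B (planar q₂ (c 0) 0) D₂ := hasH1Gradient_planar c hLam hW hq₂ hBb 0
  have hV₂ := (hP₁.add hB hP₂.neg).cutoff_mul_h10 hB hχ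
    (fun y => abs_le.2 ⟨by linarith [(hχ01 y).1], (hχ01 y).2⟩) hχK hχc hχB
  have hV := hV₁.add hB hV₂
  have hv := hV.hasH1Gradient.add hB hP₂
  -- On `A'` this is the translated competitor, since χ = 1 there; elsewhere it interpolates between
  -- the two planar functions. The first two summands lie in `H¹₀(B)`, which gives the boundary
  -- condition.
  set v := A'.indicator (fun y => (u - planar q₁ (c 0) 0) (y - x)) +
    (fun y => χ y * (planar q₁ (c 0) x + -planar q₂ (c 0) 0) y) + planar q₂ (c 0) 0 with hvdef
  set G := A'.indicator (fun y => g₁ (y - x)) + (fun y => χ y • (D₁ + -D₂) y +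
      (planar q₁ (c 0) x + -planar q₂ (c 0) 0) y • gradient χ y) + D₂ with hGdef
  have hvin : ∀ y ∈ A', v y = u (y - x) := fun y hy => by
    simp only [hvdef, Pi.add_apply, indicator_of_mem hy, Pi.sub_apply, Pi.neg_apply, planar,
      hχ1 y hy, sub_zero]
    ring
  have hGin : ∀ y ∈ A', G y = g₁ (y - x) + deriv q₁ (inner ℝ (y - x - 0) (c 0)) • c 0 :=
    fun y hy => by
      have h0 : gradient χ y = 0 := by
        have : χ =ᶠ[𝓝 y] fun _ => (1 : ℝ) := by
          filter_upwards [hA'o.mem_nhds hy] with z hz using hχ1 z hz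
        simp [gradient, this.fderiv_eq]
      simp only [hGdef, hD₁, hD₂, Pi.add_apply, indicator_of_mem hy, Pi.neg_apply, hχ1 y hy, h0, smul_zero,
        sub_zero, one_smul]
      abel
  have hvout : ∀ y ∉ A', v y = χ y * q₁ (inner ℝ y (c 0) - inner ℝ x (c 0)) +
      (1 - χ y) * q₂ (inner ℝ y (c 0)) := fun y hy => by
    simp only [hvdef, Pi.add_apply, indicator_of_notMem hy, Pi.neg_apply, planar, sub_zero,
      inner_sub_left]
    ring
  have hGout : ∀ y ∉ A', G y = (χ y * deriv q₁ (inner ℝ y (c 0) - inner ℝ x (c 0)) +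
      (1 - χ y) * deriv q₂ (inner ℝ y (c 0))) • c 0 +
      (q₁ (inner ℝ y (c 0) - inner ℝ x (c 0)) - q₂ (inner ℝ y (c 0))) • gradient χ y :=
    fun y hy => by
      simp only [hGdef, hD₁, hD₂, Pi.add_apply, indicator_of_notMem hy, Pi.neg_apply, planar,
        sub_zero, inner_sub_left]
      module
  have huA' : ∀ᵐ y ∂(volume.restrict A'), u (y - x) ∈ Icc (-1 : ℝ) 1 :=
    hmp.quasiMeasurePreserving.ae hu1
  have hv1 : ∀ᵐ y ∂(volume.restrict B), v y ∈ Icc (-1 : ℝ) 1 := by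
    rw [ae_restrict_iff' hA'o.measurableSet] at huA'
    refine ae_restrict_of_ae ?_
    filter_upwards [huA'] with y hy
    by_cases hyA : y ∈ A'
    · rw [hvin y hyA]; exact hy hyA
    · rw [hvout y hyA]
      exact convexComb_mem_Icc (hq₁.mem_Icc _) (hq₂.mem_Icc _) (hχ01 y)
  have hmem : MemH10 B (v - planar q₂ (c 0) 0) := by
    rw [hvdef, add_sub_cancel_right]
    exact memH10_iff_exists.2 ⟨_, hV⟩
  have hle : finiteVolume W τ Φ q₂ ω (c 0) 0 B ≤ energy W τ Φ ω B v G :=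
    sInf_le ⟨v, G, hv, hv1, hmem, rfl⟩
  have hBsplit : B = A' ∪ B \ A' := (union_sdiff_cancel hAB).symm
  have hE : energy W τ Φ ω B v G ≤
      (∫⁻ y in A', ENNReal.ofReal (1 / 2 * finslerMetric τ Φ ω y (G y) ^ 2 + W (v y))) +
      ∫⁻ y in B \ A', ENNReal.ofReal (1 / 2 * finslerMetric τ Φ ω y (G y) ^ 2 + W (v y)) := by
    unfold energy
    conv_lhs => rw [hBsplit]
    exact lintegral_union_le _ _ _
  refine hle.trans (hE.trans (add_le_add (le_of_eq ?_) ?_))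
  · have hemb : MeasurableEmbedding fun y : E d => y - x :=
      (MeasurableEquiv.subRight x).measurableEmbedding
    have hcov := (measurePreserving_sub_right volume x).setLIntegral_comp_preimage_emb hemb
      (fun y => ENNReal.ofReal (1 / 2 * finslerMetric τ Φ (τ x ω) y (g y) ^ 2 + W (u y))) A
    rw [energy, ← hcov]
    refine lintegral_congr_ae ?_
    filter_upwards [hmp.quasiMeasurePreserving.ae hgeq, ae_restrict_mem hA'o.measurableSet]
      with y hy hyA
    rw [hvin y hyA, hGin y hyA, hy]
    simp only [finslerMetric, Pi.add_apply]
    -- Stationarity: τ_{y-x} τ_x = τ_y.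
    rw [← Function.comp_apply (f := τ (y - x)), ← hτ, sub_add_cancel]
  · refine setLIntegral_mono' (hB.measurableSet.diff hA'o.measurableSet) fun y hy => ?_
    refine ENNReal.ofReal_le_ofReal ?_
    rw [hvout y hy.2, finslerMetric]
    refine add_le_add ((half_sq_homogExt_le hLam _ _).trans ?_) le_rfl
    gcongr
    rw [hGout y hy.2]
    refine (norm_add_le _ _).trans (add_le_add ?_ ?_)
    · rw [norm_smul, c.norm_eq_one, mul_one, Real.norm_eq_abs]
    · rw [norm_smul, Real.norm_eq_abs, mul_comm]
      gcongr
      exact hχK y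

end Glue

/-! ### Cylinders -/

section Cylinder

variable {n d : ℕ} (c : OrthonormalBasis (Fin (n + 1)) ℝ (E d))

/-- The cylinder of height `2 R` along `c 0`, over a cube of side length `R`. -/
def cylinder (R : ℝ) : Set (E d) :=
  box c (Fin.cons R fun _ => R / 2)

theorem mem_cylinder {R : ℝ} {y : E d} : y ∈ cylinder c R ↔
    |inner ℝ y (c 0)| < R ∧ ∀ i : Fin n, |inner ℝ y (c i.succ)| < R / 2 := by
  simp [cylinder, box, Fin.forall_fin_succ]

theorem isOpen_cylinder (R : ℝ) : IsOpen (cylinder c R) := isOpen_box c _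

theorem isBounded_cylinder (R : ℝ) : Bornology.IsBounded (cylinder c R) :=
  (isCompact_closed_box c _).isBounded.subset fun _ hy i => (hy i).le

theorem abs_inner_le_norm (y : E d) (i : Fin (n + 1)) : |inner ℝ y (c i)| ≤ ‖y‖ := by
  simpa using abs_real_inner_le_norm y (c i)

theorem exists_cylinder_cutoff : ∃ K : NNReal, ∀ (x : E d) (R R' : ℝ), R + 2 * ‖x‖ + 3 ≤ R' →
    ∃ χ : E d → ℝ, ContDiff ℝ ((⊤ : ℕ∞) : WithTop ℕ∞) χ ∧ (∀ y, χ y ∈ Icc (0 : ℝ) 1) ∧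
    (∀ y, ‖gradient χ y‖ ≤ K) ∧ (∀ y, y - x ∈ cylinder c R → χ y = 1) ∧
    HasCompactSupport χ ∧ tsupport χ ⊆ cylinder c R' := by
  obtain ⟨K, hK⟩ := exists_cutoff c
  refine ⟨K, fun x R R' hR => ?_⟩
  have hx := norm_nonneg x
  -- This box contains the translated cylinder. Strict inclusion of the support needs R/2 + ‖x‖ + 1
  -- < R'/2, which the margin 3 provides.
  obtain ⟨χ, h1, h2, h3, h4, h5⟩ := hK (Fin.cons (R + ‖x‖) fun _ => R / 2 + ‖x‖)
  refine ⟨χ, h1, h2, h3, fun y hy => h4 y ?_, ?_, ?_⟩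
  · have hi : ∀ i, |inner ℝ y (c i)| ≤ |inner ℝ (y - x) (c i)| + ‖x‖ := fun i => by
      have : inner ℝ y (c i) = inner ℝ (y - x) (c i) + inner ℝ x (c i) := by
        rw [← inner_add_left, sub_add_cancel]
      rw [this]
      exact (abs_add_le _ _).trans (add_le_add le_rfl (abs_inner_le_norm c x i))
    rw [mem_cylinder] at hy
    refine Fin.forall_fin_succ.2 ⟨?_, fun i => ?_⟩
    · have := hi 0; simp only [Fin.cons_zero]; linarith [hy.1]
    · have := hi i.succ; simp only [Fin.cons_succ]; linarith [hy.2 i]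
  · exact (isCompact_closed_box c _).of_isClosed_subset (isClosed_tsupport χ) h5
  · intro y hy
    have := h5 hy
    rw [mem_ofPred_eq, Fin.forall_fin_succ] at this
    simp only [Fin.cons_zero, Fin.cons_succ] at this
    refine (mem_cylinder c).2 ⟨?_, fun i => ?_⟩
    · linarith [this.1]
    · linarith [this.2 i]

theorem preimage_cylinder_subset {x : E d} {R R' : ℝ} (hR : R + 2 * ‖x‖ + 3 ≤ R') :
    (fun y => y - x) ⁻¹' cylinder c R ⊆ cylinder c R' := by
  obtain ⟨K, hK⟩ := exists_cylinder_cutoff c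
  obtain ⟨χ, -, -, -, h4, -, h6⟩ := hK x R R' hR
  exact fun y hy => h6 (subset_tsupport χ (by simp [h4 y hy]))

/-- The volume of a centred cube of side length `r`. -/
theorem volume_pi_cube (n : ℕ) {r : ℝ} (hr : 0 ≤ r) :
    volume (univ.pi fun _ : Fin n => Ioo (-(r / 2)) (r / 2)) = ENNReal.ofReal (r ^ n) := by
  rw [Real.volume_pi_Ioo, Finset.prod_const, Finset.card_univ, Fintype.card_fin,
    ENNReal.ofReal_pow hr]
  congr 2
  ring

/-- The lateral layer has cross section of order r^(n-1); multiplying by r avoids that exponent when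
n = 0. -/
theorem pow_sub_pow_mul_le {s r : ℝ} (hs : 0 ≤ s) (hsr : s ≤ r) (n : ℕ) :
    (r ^ n - s ^ n) * r ≤ n * (r - s) * r ^ n := by
  rcases n with _ | m
  · simp
  have h := abs_pow_sub_pow_le r s (m + 1)
  rw [abs_of_nonneg (sub_nonneg.2 (pow_le_pow_left₀ hs hsr _)), abs_of_nonneg (sub_nonneg.2 hsr),
    abs_of_nonneg hs, abs_of_nonneg (hs.trans hsr), max_eq_left hsr] at h
  calc _ ≤ _ := mul_le_mul_of_nonneg_right h (hs.trans hsr)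
    _ = _ := by rw [Nat.add_sub_cancel]; ring

/-- A function of the height, integrated over the layer between two cylinders. -/
theorem lintegral_layer_le {x : E d} {R R' : ℝ} (hx : 2 * ‖x‖ ≤ R) (hR : R ≤ R')
    {F : ℝ → ℝ≥0∞} (hF : Measurable F) :
    ∫⁻ y in cylinder c R' \ (fun y => y - x) ⁻¹' cylinder c R, F (inner ℝ y (c 0)) ≤
      ENNReal.ofReal (R' ^ n - (R - 2 * ‖x‖) ^ n) * (∫⁻ t in Ioo (-R') R', F t) +
      ENNReal.ofReal (R' ^ n) *
        ∫⁻ t in Ioo (-R') R' \ Ioo (-(R - ‖x‖)) (R - ‖x‖), F t := by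
  have hx0 := norm_nonneg x
  set T : ℝ → Set (Fin n → ℝ) := fun r => univ.pi fun _ => Ioo (-(r / 2)) (r / 2) with hT
  have hTm : ∀ r, MeasurableSet (T r) := fun r => MeasurableSet.univ_pi fun _ => measurableSet_Ioo
  have hsub : T (R - 2 * ‖x‖) ⊆ T R' := pi_mono fun i _ => Ioo_subset_Ioo (by linarith) (by linarith)
  have hvol : volume (T R' \ T (R - 2 * ‖x‖)) = ENNReal.ofReal (R' ^ n - (R - 2 * ‖x‖) ^ n) := by
    rw [measure_sdiff hsub (hTm _).nullMeasurableSet, volume_pi_cube n (by linarith),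
      volume_pi_cube n (by linarith), ENNReal.ofReal_sub _ (pow_nonneg (by linarith) n)]
    rw [volume_pi_cube n (by linarith)]
    exact ENNReal.ofReal_ne_top
  set Z₁ : Set (E d) := {y | inner ℝ y (c 0) ∈ Ioo (-R') R' ∧
    (fun i : Fin n => inner ℝ y (c i.succ)) ∈ T R' \ T (R - 2 * ‖x‖)}
  set Z₂ : Set (E d) := {y | inner ℝ y (c 0) ∈ Ioo (-R') R' \ Ioo (-(R - ‖x‖)) (R - ‖x‖) ∧
    (fun i : Fin n => inner ℝ y (c i.succ)) ∈ T R'}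
  -- A translation by x moves each coordinate by at most ‖x‖, so a point of the layer is either
  -- lateral (outside the cross section of side R - 2‖x‖) or in a cap (height at least R - ‖x‖).
  have hcover : cylinder c R' \ (fun y => y - x) ⁻¹' cylinder c R ⊆ Z₁ ∪ Z₂ := by
    rintro y ⟨hy1, hy2⟩
    rw [mem_cylinder] at hy1
    have hyT : (fun i : Fin n => inner ℝ y (c i.succ)) ∈ T R' :=
      fun i _ => abs_lt.1 (hy1.2 i)
    by_cases h0 : inner ℝ y (c 0) ∈ Ioo (-(R - ‖x‖)) (R - ‖x‖)
    · refine Or.inl ⟨abs_lt.1 hy1.1, hyT, fun hmem => hy2 ((mem_cylinder c).2 ⟨?_, fun i => ?_⟩)⟩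
      · rw [inner_sub_left]
        have h1 := abs_lt.2 h0
        have h2 := abs_inner_le_norm c x 0
        exact (abs_sub _ _).trans_lt (by linarith)
      · rw [inner_sub_left]
        have h1 := abs_lt.2 (hmem i (mem_univ i))
        have h2 := abs_inner_le_norm c x i.succ
        exact (abs_sub _ _).trans_lt (by linarith)
    · exact Or.inr ⟨⟨abs_lt.1 hy1.1, h0⟩, hyT⟩
  refine (lintegral_mono_set hcover).trans ((lintegral_union_le _ _ _).trans (add_le_add ?_ ?_))
  · rw [← hvol]
    exact setLIntegral_inner_le c measurableSet_Ioo ((hTm _).diff (hTm _)) (fun y hy => hy) hF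
  · rw [← volume_pi_cube n (by linarith : 0 ≤ R')]
    exact setLIntegral_inner_le c (measurableSet_Ioo.diff measurableSet_Ioo) (hTm _)
      (fun y hy => hy) hF

theorem tendsto_lintegral_tail {ψ : ℝ → ℝ≥0∞} (hψ : Measurable ψ) (hfin : ∫⁻ t, ψ t ≠ ⊤)
    (a : ℝ) :
    Tendsto (fun R : ℝ => ∫⁻ t in (Ioo (-(R - a)) (R - a))ᶜ, ψ t) atTop (𝓝 0) := by
  have h0 : (0 : ℝ≥0∞) = ∫⁻ _ : ℝ, 0 := by simp
  simp_rw [← lintegral_indicator (measurableSet_Ioo.compl)]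
  rw [h0]
  refine tendsto_lintegral_filter_of_dominated_convergence ψ (.of_forall fun R =>
    hψ.indicator measurableSet_Ioo.compl) (.of_forall fun R => .of_forall fun t =>
      indicator_le_self _ _ t) hfin (.of_forall fun t => ?_)
  refine tendsto_const_nhds.congr' ?_
  filter_upwards [eventually_gt_atTop (|t| + a)] with R hR
  rw [indicator_of_notMem]
  rw [notMem_compl_iff]
  exact abs_lt.1 (by linarith)

end Cylinder


/-! ### Asymptotic comparison of finite-volume surface tensions -/

section Comparison

variable {n d : ℕ} {lam Lam : ℝ} {Ω : Type*} {W q q₁ q₂ : ℝ → ℝ} {τ : E d → Ω → Ω}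
  {Φ : Ω → FinslerNorms d lam Lam}

theorem volume_Ioo_diff_Ioo_le (s r : ℝ) :
    volume (Ioo (-r) r \ Ioo (-s) s) ≤ ENNReal.ofReal (2 * (r - s)) := by
  have hsub : Ioo (-r) r \ Ioo (-s) s ⊆ Icc (-r) (-s) ∪ Icc s r := by
    rintro t ⟨ht, hts⟩
    rw [mem_Ioo, not_and_or, not_lt, not_lt] at hts
    exact hts.imp (fun h => ⟨ht.1.le, h⟩) fun h => ⟨h, ht.2.le⟩
  rcases le_total r s with h | h
  · have : Ioo (-r) r \ Ioo (-s) s = ∅ :=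
      sdiff_eq_empty.2 (Ioo_subset_Ioo (by linarith) h)
    simp [this]
  refine (measure_mono hsub).trans ((measure_union_le _ _).trans ?_)
  rw [Real.volume_Icc, Real.volume_Icc, ← ENNReal.ofReal_add (by linarith) (by linarith)]
  exact ENNReal.ofReal_le_ofReal (by linarith)

/-- Up to an error that is small compared with the cross section, the layer between two cylinders
at bounded distance carries no energy. -/
theorem eventually_layer_le (c : OrthonormalBasis (Fin (n + 1)) ℝ (E d)) (x : E d) {δ : ℝ}
    (hδ : 0 < δ) : ∃ ε : ℝ, 0 < ε ∧ ∀ ψ : ℝ → ℝ, Measurable ψ → Integrable ψ →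
    ∀ᶠ R : ℝ in atTop, ∀ R' ∈ Icc (R + 2 * ‖x‖ + 3) (R + 2 * ‖x‖ + 5),
      ∫⁻ y in cylinder c R' \ (fun y => y - x) ⁻¹' cylinder c R,
        (ENNReal.ofReal ε + ENNReal.ofReal (ψ (inner ℝ y (c 0)))) ≤
      ENNReal.ofReal (R ^ n) * ENNReal.ofReal δ := by
  set a := ‖x‖ with ha
  have ha0 : 0 ≤ a := norm_nonneg x
  -- The sides differ by R' - (R - 2a) ≤ 4a + 5 and R' ≤ 2R, so the lateral cross section is at most
  -- R^n M / R'.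
  set M : ℝ := n * (4 * a + 5) * 2 ^ n with hM
  have hM0 : 0 ≤ M := by positivity
  -- The cost of a unit density per R^n: 2M for the lateral layer of height 2R', the rest for two
  -- caps of thickness at most 3a + 5.
  set C : ℝ := 2 * M + 2 ^ n * (2 * (3 * a + 5)) with hC
  have hC0 : 0 ≤ C := by positivity
  set ε : ℝ := δ / (2 * (C + 1)) with hε
  have hε0 : 0 < ε := by positivity
  have hεC : ε * C ≤ δ / 2 := by
    rw [hε, div_mul_eq_mul_div, div_le_div_iff₀ (by positivity) (by positivity)]
    nlinarith
  -- ε must be fixed before ψ, because the ψ of `exists_interpolation_density_bound` depends on ε.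
  -- Half of δ pays for ε, half for ψ.
  refine ⟨ε, hε0, fun ψ hψm hψi => ?_⟩
  set I : ℝ≥0∞ := ∫⁻ t, ENNReal.ofReal (ψ t) with hI
  have hIfin : I ≠ ⊤ := hψi.lintegral_lt_top.ne
  set J : ℝ → ℝ≥0∞ := fun R => ∫⁻ t in (Ioo (-(R - a)) (R - a))ᶜ, ENNReal.ofReal (ψ t) with hJ
  have hsmall : Tendsto (fun R : ℝ => ENNReal.ofReal (M / R) * I + ENNReal.ofReal (2 ^ n) * J R)
      atTop (𝓝 0) := by
    have h1 : Tendsto (fun R : ℝ => ENNReal.ofReal (M / R)) atTop (𝓝 0) := by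
      simpa using ENNReal.tendsto_ofReal (tendsto_const_nhds.div_atTop tendsto_id)
    have h2 := ENNReal.Tendsto.mul_const h1 (Or.inr hIfin)
    have h3 := ENNReal.Tendsto.const_mul (tendsto_lintegral_tail hψm.ennreal_ofReal hIfin a)
      (Or.inr (ENNReal.ofReal_ne_top (r := 2 ^ n)))
    simpa only [zero_mul, mul_zero, add_zero] using h2.add h3
  filter_upwards [hsmall.eventually_le_const (ENNReal.ofReal_pos.2 (half_pos hδ)),
    eventually_ge_atTop (2 * a + 5)] with R hR1 hR2 R' hR'
  have hRpos : 0 < R := by linarith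
  have hR'pos : 0 < R' := by linarith [hR'.1]
  have hR'2 : R' ^ n ≤ R ^ n * 2 ^ n := by
    rw [← mul_pow]; exact pow_le_pow_left₀ hR'pos.le (by linarith [hR'.2]) n
  have hV₁ : ENNReal.ofReal (R' ^ n - (R - 2 * a) ^ n) ≤
      ENNReal.ofReal (R ^ n) * ENNReal.ofReal (M / R') := by
    rw [← ENNReal.ofReal_mul (by positivity)]
    refine ENNReal.ofReal_le_ofReal ?_
    rw [← mul_div_assoc, le_div_iff₀ hR'pos]
    calc _ ≤ n * (R' - (R - 2 * a)) * R' ^ n :=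
          pow_sub_pow_mul_le (by linarith) (by linarith [hR'.1]) n
      _ ≤ n * (4 * a + 5) * (R ^ n * 2 ^ n) := by
          gcongr
          linarith [hR'.2]
      _ = _ := by rw [hM]; ring
  have hV₂ : ENNReal.ofReal (R' ^ n) ≤ ENNReal.ofReal (R ^ n) * ENNReal.ofReal (2 ^ n) := by
    rw [← ENNReal.ofReal_mul (by positivity)]
    exact ENNReal.ofReal_le_ofReal hR'2
  have hF₁ : ∫⁻ t in Ioo (-R') R', (ENNReal.ofReal ε + ENNReal.ofReal (ψ t)) ≤
      ENNReal.ofReal (2 * ε * R') + I := by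
    rw [lintegral_add_left measurable_const, setLIntegral_const, Real.volume_Ioo,
      ← ENNReal.ofReal_mul hε0.le]
    refine add_le_add (ENNReal.ofReal_le_ofReal (by linarith)) (setLIntegral_le_lintegral _ _)
  have hF₂ : ∫⁻ t in Ioo (-R') R' \ Ioo (-(R - a)) (R - a),
      (ENNReal.ofReal ε + ENNReal.ofReal (ψ t)) ≤
      ENNReal.ofReal (ε * (2 * (3 * a + 5))) + J R := by
    rw [lintegral_add_left measurable_const, setLIntegral_const]
    refine add_le_add ?_ (lintegral_mono_set fun t ht => ht.2)
    rw [ENNReal.ofReal_mul hε0.le]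
    gcongr
    refine (volume_Ioo_diff_Ioo_le _ _).trans (ENNReal.ofReal_le_ofReal ?_)
    linarith [hR'.2]
  calc _ ≤ _ := lintegral_layer_le c (by linarith) (by linarith [hR'.1])
        (measurable_const.add hψm.ennreal_ofReal)
    _ ≤ ENNReal.ofReal (R ^ n) * ENNReal.ofReal (M / R') * (ENNReal.ofReal (2 * ε * R') + I) +
        ENNReal.ofReal (R ^ n) * ENNReal.ofReal (2 ^ n) *
          (ENNReal.ofReal (ε * (2 * (3 * a + 5))) + J R) :=
        add_le_add (mul_le_mul' hV₁ hF₁) (mul_le_mul' hV₂ hF₂)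
    _ = ENNReal.ofReal (R ^ n) * ((ENNReal.ofReal (M / R') * ENNReal.ofReal (2 * ε * R') +
          ENNReal.ofReal (2 ^ n) * ENNReal.ofReal (ε * (2 * (3 * a + 5)))) +
          (ENNReal.ofReal (M / R') * I + ENNReal.ofReal (2 ^ n) * J R)) := by ring
    _ ≤ ENNReal.ofReal (R ^ n) * (ENNReal.ofReal (δ / 2) + ENNReal.ofReal (δ / 2)) := by
        gcongr
        · rw [← ENNReal.ofReal_mul (by positivity), ← ENNReal.ofReal_mul (by positivity),
            ← ENNReal.ofReal_add (by positivity) (by positivity)]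
          refine ENNReal.ofReal_le_ofReal (le_trans (le_of_eq ?_) hεC)
          rw [hC]; field_simp
        · refine le_trans ?_ hR1
          gcongr
          linarith [hR'.1]
    _ = _ := by rw [← ENNReal.ofReal_add (by positivity) (by positivity), add_halves]

/-- The central comparison. In the layer the medium enters only through the bound `Lam`, so the
error and the threshold for R do not depend on ω. -/
theorem eventually_finiteVolume_le (hLam : 0 < Lam) (hW : IsDoubleWell W)
    (hτ : ∀ x y, τ (x + y) = τ x ∘ τ y) (c : OrthonormalBasis (Fin (n + 1)) ℝ (E d))
    (hq₁ : IsProfile Lam W q₁) (hq₂ : IsProfile Lam W q₂) (x : E d) {δ : ℝ} (hδ : 0 < δ) :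
    ∀ᶠ R : ℝ in atTop, ∀ R' ∈ Icc (R + 2 * ‖x‖ + 3) (R + 2 * ‖x‖ + 5), ∀ ω,
      finiteVolume W τ Φ q₂ ω (c 0) 0 (cylinder c R') ≤
        finiteVolume W τ Φ q₁ (τ x ω) (c 0) 0 (cylinder c R) +
          ENNReal.ofReal (R ^ n) * ENNReal.ofReal δ := by
  obtain ⟨K, hK⟩ := exists_cylinder_cutoff c
  obtain ⟨ε, hε, hlayer⟩ := eventually_layer_le c x hδ
  obtain ⟨ψ, hψm, hψ0, hψi, hψ⟩ :=
    exists_interpolation_density_bound hLam hW hq₁ hq₂ (inner ℝ x (c 0)) K hε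
  filter_upwards [hlayer ψ hψm hψi] with R hR R' hR' ω
  obtain ⟨χ, h1, h2, h3, h4, h5, h6⟩ := hK x R R' hR'.1
  rw [finiteVolume.eq_1 (q := q₁), ENNReal.sInf_add]
  refine le_iInf₂ ?_
  rintro _ ⟨u, g, hug, hu1, hu0, rfl⟩
  refine (finiteVolume_le_energy_add hLam hW hτ c hq₁ hq₂ (isOpen_cylinder c R)
    (isBounded_cylinder c R) (isOpen_cylinder c R') (isBounded_cylinder c R') x
    (preimage_cylinder_subset c hR'.1) h1 h2 h3 h4 h5 h6 hug hu1 hu0).trans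
    (add_le_add le_rfl (le_trans ?_ (hR R' hR')))
  refine lintegral_mono fun y => ?_
  rw [← ENNReal.ofReal_add hε.le (hψ0 _)]
  exact ENNReal.ofReal_le_ofReal (hψ _ _ (h2 y))

/-- The planar function is itself a competitor. -/
theorem finiteVolume_cylinder_le (hLam : 0 < Lam) (hW : IsDoubleWell W)
    (c : OrthonormalBasis (Fin (n + 1)) ℝ (E d)) (hq : IsProfile Lam W q) (ω : Ω) {R : ℝ}
    (hR : 0 ≤ R) :
    finiteVolume W τ Φ q ω (c 0) 0 (cylinder c R) ≤ ENNReal.ofReal (R ^ n) *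
      ∫⁻ t, ENNReal.ofReal (Lam / 2 * deriv q t ^ 2 + W (q t)) := by
  have hP := hasH1Gradient_planar c hLam hW hq (isBounded_cylinder c R) 0
  have h0 : MemH10 (cylinder c R) (planar q (c 0) 0 - planar q (c 0) 0) := by
    rw [sub_self]
    refine ⟨MemLp.zero, 0, MemLp.zero, fun ε hε =>
      ⟨0, contDiff_const, HasCompactSupport.zero, by simp [tsupport], by simpa using hε, ?_⟩⟩
    have : gradient (0 : E d → ℝ) = 0 := gradient_const' (F := E d) (0 : ℝ)
    rw [this]; simpa using hε
  have hle : finiteVolume W τ Φ q ω (c 0) 0 (cylinder c R) ≤ energy W τ Φ ω (cylinder c R) _ _ :=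
    sInf_le ⟨_, _, hP, .of_forall fun y => hq.mem_Icc _, h0, rfl⟩
  have hF : Measurable fun t => ENNReal.ofReal (Lam / 2 * deriv q t ^ 2 + W (q t)) :=
    ((((measurable_deriv q).pow_const 2).const_mul _).add
      (hq.continuous_potential hW).measurable).ennreal_ofReal
  refine hle.trans (le_trans ?_ ((setLIntegral_inner_le c (S := univ) MeasurableSet.univ
    (T := univ.pi fun _ : Fin n => Ioo (-(R / 2)) (R / 2))
    (MeasurableSet.univ_pi fun _ => measurableSet_Ioo) (A := cylinder c R) (fun y hy =>
      ⟨mem_univ _, fun i _ => abs_lt.1 (((mem_cylinder c).1 hy).2 i)⟩) hF).trans ?_))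
  · refine lintegral_mono fun y => ENNReal.ofReal_le_ofReal ?_
    simp only [planar, sub_zero]
    refine add_le_add ((half_sq_homogExt_le hLam _ _).trans ?_) le_rfl
    rw [norm_smul, c.norm_eq_one, mul_one, Real.norm_eq_abs, sq_abs]
  · rw [volume_pi_cube n hR, setLIntegral_univ]

end Comparison

/-! ### The infinite-volume surface tension -/

section InfiniteVolume

variable {n d : ℕ} {lam Lam : ℝ} {Ω : Type*} {W q q₁ q₂ : ℝ → ℝ} {τ : E d → Ω → Ω}
  {Φ : Ω → FinslerNorms d lam Lam} {b : OrthonormalBasis (Fin n) ℝ (E n)} {O : E n →ₗᵢ[ℝ] E d}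
  {e : E d}

/-- In this basis the domains become boxes, with the height as coordinate 0. -/
theorem exists_adapted_basis (b : OrthonormalBasis (Fin n) ℝ (E n)) (he : ‖e‖ = 1)
    (hO : range O = {x : E d | inner ℝ x e = 0}) :
    ∃ c : OrthonormalBasis (Fin (n + 1)) ℝ (E d), c 0 = e ∧ ∀ i : Fin n, c i.succ = O (b i) := by
  have hOe : ∀ y, inner ℝ (O y) e = 0 := fun y => by
    have : O y ∈ {x : E d | inner ℝ x e = 0} := hO ▸ mem_range_self y
    exact this
  let w : Fin (n + 1) → E d := Fin.cons e fun i => O (b i)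
  have hw : Orthonormal ℝ w := by
    rw [orthonormal_iff_ite]
    intro i j
    refine Fin.cases ?_ (fun i => ?_) i <;> refine Fin.cases ?_ (fun j => ?_) j
    · simp [w, he]
    · simp [w, fun y => (real_inner_comm (O y) e).trans (hOe y), (Fin.succ_ne_zero j).symm]
    · simp [w, hOe]
    · simp [w, O.inner_map_map, orthonormal_iff_ite.1 b.orthonormal i j]
  have hsp : ⊤ ≤ Submodule.span ℝ (range w) := by
    intro z _
    have hee : inner ℝ e e = (1 : ℝ) := by rw [real_inner_self_eq_norm_sq, he, one_pow]
    have hz : z - (inner ℝ z e : ℝ) • e ∈ range O := by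
      rw [hO, mem_ofPred_eq, inner_sub_left, inner_smul_left, hee]
      simp
    obtain ⟨y, hy⟩ := hz
    have hzy : z = (inner ℝ z e : ℝ) • e + ∑ i, (inner ℝ (b i) y : ℝ) • O (b i) := by
      have : O y = ∑ i, (inner ℝ (b i) y : ℝ) • O (b i) := by
        conv_lhs => rw [← b.sum_repr' y]
        simp
      rw [← this, hy, add_sub_cancel]
    rw [hzy]
    refine add_mem (Submodule.smul_mem _ _ (Submodule.subset_span ⟨0, rfl⟩))
      (Submodule.sum_mem _ fun i _ => Submodule.smul_mem _ _ (Submodule.subset_span ⟨i.succ, rfl⟩))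
  refine ⟨OrthonormalBasis.mk hw hsp, ?_, fun i => ?_⟩
  · simp [w]
  · simp [w]

theorem directSum_eq_cylinder {c : OrthonormalBasis (Fin (n + 1)) ℝ (E d)} (hc : c 0 = e)
    (hcb : ∀ i : Fin n, c i.succ = O (b i)) (R : ℝ) :
    directSum O e (cube b 0 R) (Ioo (-R) R) = cylinder c R := by
  have h1 : ∀ y, inner ℝ (O y) e = 0 := fun y => by
    rw [← b.sum_repr' y]
    simp only [map_sum, map_smul, sum_inner, inner_smul_left, ← hcb, ← hc]
    refine Finset.sum_eq_zero fun i _ => ?_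
    rw [c.orthonormal.2 (Fin.succ_ne_zero i), mul_zero]
  have h2 : ∀ i, inner ℝ e (O (b i)) = 0 := fun i => by rw [real_inner_comm, h1]
  have hee : inner ℝ e e = (1 : ℝ) := by
    rw [real_inner_self_eq_norm_sq, ← hc, c.norm_eq_one, one_pow]
  ext z
  rw [mem_cylinder, hc]
  simp only [hcb]
  constructor
  · rintro ⟨y, hy, t, ht, rfl⟩
    simp only [inner_add_left, inner_smul_left, h1, h2, hee, O.inner_map_map]
    refine ⟨by simpa using abs_lt.2 ht, fun i => ?_⟩
    simpa using hy i
  · rintro ⟨hz1, hz2⟩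
    refine ⟨∑ i, (inner ℝ z (O (b i)) : ℝ) • b i, fun i => ?_, inner ℝ z e, abs_lt.1 hz1, ?_⟩
    · rw [sub_zero, sum_inner]
      simp only [inner_smul_left, orthonormal_iff_ite.1 b.orthonormal]
      simpa using hz2 i
    · conv_lhs => rw [← c.sum_repr' z]
      rw [Fin.sum_univ_succ, hc, add_comm]
      simp [hcb, real_inner_comm]

/-- The rescaled finite-volume surface tension. -/
noncomputable def rescaled (W : ℝ → ℝ) (τ : E d → Ω → Ω) (Φ : Ω → FinslerNorms d lam Lam) (q : ℝ → ℝ)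
    (b : OrthonormalBasis (Fin n) ℝ (E n)) (O : E n →ₗᵢ[ℝ] E d) (e : E d) (ω : Ω) (R : ℝ) :
    ℝ≥0∞ :=
  ENNReal.ofReal (R ^ (1 - (d : ℝ))) * centered W τ Φ q O ω e (cube b 0 R) R

theorem rescaled_eq (hd : n + 1 = d) {c : OrthonormalBasis (Fin (n + 1)) ℝ (E d)} (hc : c 0 = e)
    (hcb : ∀ i : Fin n, c i.succ = O (b i)) {R : ℝ} (hR : 0 < R) (ω : Ω) :
    rescaled W τ Φ q b O e ω R = (ENNReal.ofReal (R ^ n))⁻¹ *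
      finiteVolume W τ Φ q ω (c 0) 0 (cylinder c R) := by
  have hexp : (1 - (d : ℝ)) = -(n : ℝ) := by rw [← hd]; push_cast; ring
  rw [rescaled, centered, directSum_eq_cylinder hc hcb, hc, hexp, Real.rpow_neg hR.le,
    Real.rpow_natCast, ENNReal.ofReal_inv_of_pos (by positivity)]

theorem eventually_rescaled_le (hLam : 0 < Lam) (hW : IsDoubleWell W)
    (hτ : ∀ x y, τ (x + y) = τ x ∘ τ y) (hd : n + 1 = d) (he : ‖e‖ = 1)
    (hO : range O = {x : E d | inner ℝ x e = 0})
    (hq₁ : IsProfile Lam W q₁) (hq₂ : IsProfile Lam W q₂) (x : E d) {δ : ℝ} (hδ : 0 < δ) :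
    ∀ᶠ R : ℝ in atTop, ∀ R' ∈ Icc (R + 2 * ‖x‖ + 3) (R + 2 * ‖x‖ + 5), ∀ ω,
      rescaled W τ Φ q₂ b O e ω R' ≤ rescaled W τ Φ q₁ b O e (τ x ω) R + ENNReal.ofReal δ := by
  obtain ⟨c, hc, hcb⟩ := exists_adapted_basis b he hO
  filter_upwards [eventually_finiteVolume_le hLam hW hτ c hq₁ hq₂ x hδ (Φ := Φ),
    eventually_gt_atTop 0] with R hR hRpos R' hR' ω
  have hRR' : R ≤ R' := by linarith [hR'.1, norm_nonneg x]
  have hpow : ENNReal.ofReal (R ^ n) ≠ 0 := (ENNReal.ofReal_pos.2 (by positivity)).ne'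
  rw [rescaled_eq hd hc hcb (hRpos.trans_le hRR'), rescaled_eq hd hc hcb hRpos]
  -- As R ≤ R', the normalisation by R'^n may be replaced by the larger one by R^n.
  calc _ ≤ (ENNReal.ofReal (R ^ n))⁻¹ * (finiteVolume W τ Φ q₁ (τ x ω) (c 0) 0 (cylinder c R) +
          ENNReal.ofReal (R ^ n) * ENNReal.ofReal δ) := by
        gcongr
        exact hR R' hR' ω
    _ = _ := by
        rw [mul_add, ← mul_assoc, ENNReal.inv_mul_cancel hpow ENNReal.ofReal_ne_top, one_mul]

theorem exists_lt_add_ofReal_le {r s : ℝ≥0∞} (h : r < s) :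
    ∃ δ : ℝ, 0 < δ ∧ r + ENNReal.ofReal δ ≤ s := by
  obtain ⟨δ, hδ, hδs⟩ := ENNReal.lt_iff_exists_add_pos_lt.1 h
  exact ⟨δ, hδ, by simpa using hδs.le⟩

/-- Each large real R with a nearly optimal value is followed by the integer ⌈R + 2‖x‖ + 3⌉, which
lies in the comparison window and is almost as good. -/
theorem liminf_nat_le_infiniteVolume (hLam : 0 < Lam) (hW : IsDoubleWell W)
    (hτ : ∀ x y, τ (x + y) = τ x ∘ τ y) (hd : n + 1 = d) (he : ‖e‖ = 1)
    (hO : range O = {x : E d | inner ℝ x e = 0})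
    (hq₁ : IsProfile Lam W q₁) (hq₂ : IsProfile Lam W q₂) (x : E d) (ω : Ω) :
    liminf (fun N : ℕ => rescaled W τ Φ q₂ b O e ω N) atTop ≤
      infiniteVolume W τ Φ q₁ b O e (τ x ω) := by
  refine le_of_forall_gt_imp_ge_of_dense fun r hr => ?_
  obtain ⟨r', hr', hr'r⟩ := exists_between hr
  obtain ⟨δ, hδ, hδr⟩ := exists_lt_add_ofReal_le hr'r
  have hfreq : ∃ᶠ R : ℝ in atTop, rescaled W τ Φ q₁ b O e (τ x ω) R < r' :=
    frequently_lt_of_liminf_lt (by isBoundedDefault) hr'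
  set k : ℝ → ℕ := fun R => ⌈R + 2 * ‖x‖ + 3⌉₊ with hk
  have hkt : Tendsto k atTop atTop := tendsto_nat_ceil_atTop.comp
    (tendsto_atTop_add_const_right _ _ (tendsto_atTop_add_const_right _ _ tendsto_id))
  refine liminf_le_of_frequently_le (hkt.frequently ((hfreq.and_eventually
    ((eventually_rescaled_le hLam hW hτ hd he hO hq₁ hq₂ x hδ (Φ := Φ) (b := b)).and
      (eventually_ge_atTop 0))).mono ?_))
  rintro R ⟨hR1, hR2, hR0⟩
  have hpos : 0 ≤ R + 2 * ‖x‖ + 3 := by positivity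
  have hmem : (k R : ℝ) ∈ Icc (R + 2 * ‖x‖ + 3) (R + 2 * ‖x‖ + 5) :=
    ⟨Nat.le_ceil _, by linarith [Nat.ceil_lt_add_one hpos]⟩
  exact (hR2 _ hmem ω).trans ((add_le_add_left hR1.le _).trans hδr)

theorem infiniteVolume_le_liminf_nat (ω : Ω) :
    infiniteVolume W τ Φ q b O e ω ≤
      liminf (fun N : ℕ => rescaled W τ Φ q b O e ω N) atTop :=
  liminf_le_liminf_of_le (u := rescaled W τ Φ q b O e ω) (g := map ((↑) : ℕ → ℝ) atTop)
    (f := atTop) tendsto_natCast_atTop_atTop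

theorem infiniteVolume_le (hLam : 0 < Lam) (hW : IsDoubleWell W)
    (hτ : ∀ x y, τ (x + y) = τ x ∘ τ y) (hd : n + 1 = d) (he : ‖e‖ = 1)
    (hO : range O = {x : E d | inner ℝ x e = 0})
    (hq₁ : IsProfile Lam W q₁) (hq₂ : IsProfile Lam W q₂) (x : E d) (ω : Ω) :
    infiniteVolume W τ Φ q₂ b O e ω ≤ infiniteVolume W τ Φ q₁ b O e (τ x ω) :=
  (infiniteVolume_le_liminf_nat ω).trans
    (liminf_nat_le_infiniteVolume hLam hW hτ hd he hO hq₁ hq₂ x ω)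

theorem infiniteVolume_lt_top (hLam : 0 < Lam) (hW : IsDoubleWell W) (hd : n + 1 = d)
    (he : ‖e‖ = 1) (hO : range O = {x : E d | inner ℝ x e = 0}) (hq : IsProfile Lam W q) (ω : Ω) :
    infiniteVolume W τ Φ q b O e ω < ⊤ := by
  obtain ⟨c, hc, hcb⟩ := exists_adapted_basis b he hO
  refine lt_of_le_of_lt ?_ hq.finite_energy.lintegral_lt_top
  refine liminf_le_of_frequently_le (Eventually.frequently ?_)
  filter_upwards [eventually_gt_atTop 0] with R hR
  have hpow : ENNReal.ofReal (R ^ n) ≠ 0 := (ENNReal.ofReal_pos.2 (by positivity)).ne'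
  refine (rescaled_eq hd hc hcb hR ω).le.trans ?_
  calc _ ≤ (ENNReal.ofReal (R ^ n))⁻¹ * (ENNReal.ofReal (R ^ n) *
          ∫⁻ t, ENNReal.ofReal (Lam / 2 * deriv q t ^ 2 + W (q t))) := by
        gcongr
        exact finiteVolume_cylinder_le hLam hW c hq ω hR.le
    _ = _ := by
        rw [← mul_assoc, ENNReal.inv_mul_cancel hpow ENNReal.ofReal_ne_top, one_mul]

theorem volume_cylinder_ne_top (c : OrthonormalBasis (Fin (n + 1)) ℝ (E d)) (R : ℝ) :
    volume (cylinder c R) ≠ ⊤ :=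
  (isBounded_cylinder c R).measure_lt_top.ne

variable [MeasurableSpace Ω] {P : Measure Ω}

/-- The case x = 0, q₁ = q₂ replaces the uncountable liminf by one over integers, which preserves
measurability. -/
theorem measurable_infiniteVolume (hLam : 0 < Lam) (hW : IsDoubleWell W)
    (hτ : IsErgodicAction P τ) (hΦ : Measurable[_, borel (FinslerNorms d lam Lam)] Φ)
    (hd : n + 1 = d) (he : ‖e‖ = 1) (hO : range O = {x : E d | inner ℝ x e = 0})
    (hq : IsProfile Lam W q) : Measurable fun ω => infiniteVolume W τ Φ q b O e ω := by
  obtain ⟨c, hc, hcb⟩ := exists_adapted_basis b he hO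
  have heq : (fun ω => infiniteVolume W τ Φ q b O e ω) = fun ω =>
      liminf (fun N : ℕ => rescaled W τ Φ q b O e ω N) atTop := by
    ext ω
    refine le_antisymm (infiniteVolume_le_liminf_nat ω) ?_
    have := liminf_nat_le_infiniteVolume hLam hW hτ.add hd he hO hq hq 0 ω (Φ := Φ) (b := b)
    rwa [hτ.zero] at this
  rw [heq]
  refine Measurable.liminf fun N => Measurable.const_mul ?_ _
  simp only [centered, directSum_eq_cylinder hc hcb]
  exact measurable_finiteVolume hLam hW hτ hΦ (isOpen_cylinder c _).measurableSet
    (volume_cylinder_ne_top c _) q e 0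

/-- A measurable function which is invariant under an ergodic action is almost surely constant. -/
theorem IsErgodicAction.exists_ae_eq_const [IsProbabilityMeasure P] (hτ : IsErgodicAction P τ)
    {f : Ω → ℝ≥0∞} (hf : Measurable f) (hinv : ∀ x ω, f (τ x ω) = f ω) :
    ∃ c, ∀ᵐ ω ∂P, f ω = c := by
  refine exists_eventuallyEq_const_of_forall_separating MeasurableSet fun U hU => ?_
  rcases hτ.ergodic (f ⁻¹' U) (hf hU) fun x => by ext ω; simp [hinv] with h | h
  · exact Or.inr (measure_eq_zero_iff_ae_notMem.1 h)
  · exact Or.inl ((prob_compl_eq_zero_iff (hf hU)).2 h)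

end InfiniteVolume

end SurfaceTension

open SurfaceTension
theorem theorem3p1 {d : ℕ} (hd : 1 ≤ d) {lam Lam : ℝ} (hlam : 0 < lam) (hLam : 0 < Lam)
    {W : ℝ → ℝ} (hW : IsDoubleWell W)
    {Ω : Type*} [MeasurableSpace Ω] (P : Measure Ω) [IsProbabilityMeasure P]
    (τ : E d → Ω → Ω) (hτ : IsErgodicAction P τ)
    (Φ : Ω → FinslerNorms d lam Lam) (hΦ : Measurable[_, borel (FinslerNorms d lam Lam)] Φ)
    (b : OrthonormalBasis (Fin (d - 1)) ℝ (E (d - 1)))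
    (e : E d) (he : ‖e‖ = 1)
    (O : E (d - 1) →ₗᵢ[ℝ] E d) (hO : range O = {x : E d | inner ℝ x e = 0}) :
    (∀ q : ℝ → ℝ, IsProfile Lam W q →
      (∀ ω, infiniteVolume W τ Φ q b O e ω < ⊤) ∧
      Measurable[invariantSigma τ] (fun ω => infiniteVolume W τ Φ q b O e ω) ∧
      (∀ x ω, infiniteVolume W τ Φ q b O e (τ x ω) = infiniteVolume W τ Φ q b O e ω)) ∧
    ∃! c : ℝ, 0 ≤ c ∧ ∀ q : ℝ → ℝ, IsProfile Lam W q →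
      ∀ᵐ ω ∂P, infiniteVolume W τ Φ q b O e ω = ENNReal.ofReal c := by
  have hd' : d - 1 + 1 = d := Nat.sub_add_cancel hd
  have hle : ∀ {q₁ q₂ : ℝ → ℝ}, IsProfile Lam W q₁ → IsProfile Lam W q₂ → ∀ x ω,
      infiniteVolume W τ Φ q₂ b O e ω ≤ infiniteVolume W τ Φ q₁ b O e (τ x ω) :=
    fun h₁ h₂ x ω => infiniteVolume_le hLam hW hτ.add hd' he hO h₁ h₂ x ω
  have hfin : ∀ q, IsProfile Lam W q → ∀ ω, infiniteVolume W τ Φ q b O e ω < ⊤ :=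
    fun q hq ω => infiniteVolume_lt_top hLam hW hd' he hO hq ω
  have hmeas : ∀ q, IsProfile Lam W q → Measurable fun ω => infiniteVolume W τ Φ q b O e ω :=
    fun q hq => measurable_infiniteVolume hLam hW hτ hΦ hd' he hO hq
  have hinv : ∀ q, IsProfile Lam W q → ∀ x ω,
      infiniteVolume W τ Φ q b O e (τ x ω) = infiniteVolume W τ Φ q b O e ω := by
    intro q hq x ω
    refine le_antisymm ?_ (hle hq hq x ω)
    -- The reverse inequality is the comparison for the inverse shift, started from τ_x ω.
    have := hle hq hq (-x) (τ x ω)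
    rwa [← Function.comp_apply (f := τ (-x)), ← hτ.add, neg_add_cancel, hτ.zero] at this
  refine ⟨fun q hq => ⟨hfin q hq, fun s hs => ?_, hinv q hq⟩, ?_⟩
  · refine (measurableSet_invariantSigma τ _).2 ⟨hmeas q hq hs, fun x => ?_⟩
    ext ω
    simp [hinv q hq]
  -- A profile must exist: otherwise every c ≥ 0 would qualify and uniqueness would fail.
  obtain ⟨q₀, hq₀⟩ := exists_isProfile (Lam := Lam) hW
  obtain ⟨c, hc⟩ := hτ.exists_ae_eq_const (hmeas q₀ hq₀) (hinv q₀ hq₀)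
  obtain ⟨ω₀, hω₀⟩ := hc.exists
  have hctop : c ≠ ⊤ := hω₀ ▸ (hfin q₀ hq₀ ω₀).ne
  refine ⟨c.toReal, ⟨ENNReal.toReal_nonneg, fun q hq => ?_⟩, ?_⟩
  · filter_upwards [hc] with ω hω
    rw [ENNReal.ofReal_toReal hctop, ← hω]
    -- With x = 0 and the profiles in either order, the limit is the same for `q` and `q₀` at every
    -- ω.
    refine le_antisymm ?_ ?_
    · simpa [hτ.zero] using hle hq₀ hq 0 ω
    · simpa [hτ.zero] using hle hq hq₀ 0 ω
  · rintro y ⟨hy0, hy⟩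
    obtain ⟨ω, hω1, hω2⟩ := (hc.and (hy q₀ hq₀)).exists
    rw [← hω1, hω2, ENNReal.toReal_ofReal hy0]
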